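/- **Setting.** For each $n\ge1$ let $x_{ij}=\big(\tfrac{i-1/2}{n},\tfrac{j-1/2}{n}\big)$, $i,j=1,\dots,n$, be the pixel positions in $[0,1]^2$, and let $Y_{ij}=m(x_{ij})+\varepsilon_{ij}$, where, for each $n$, the errors $\varepsilon_{ij}$ ($1\le i,j\le n$) are independent and identically distributed with a probability density $f$ on $\mathbb R$. For kernels $K:\mathbb R^2\to\mathbb R$, $L:\mathbb R\to\mathbb R$ and bandwidths $h_n,g_n>0$ put $$H_{n,x}(y)=\frac1{n^2}\sum_{i,j=1}^n \frac1{h_n^2}K\Big(\frac{x-x_{ij}}{h_n}\Big)\,\frac1{g_n}L\Big(\frac{y-Y_{ij}}{g_n}\Big).$$ Let $x_{i_0j_0}$ be the pixel position nearest to $x$ (in case of ties with the smaller index in each coordinate). Let $\mathcal N_n(x)$ be the set of local maxima $y$ of $H_{n,x}$ such that $y\le Y_{i_0j_0}$ if $H_{n,x}'(Y_{i_0j_0})\le0$ and $y>Y_{i_0j_0}$ if $H_{n,x}'(Y_{i_0j_0})>0$. The M-smoother $m_n(x)$ is the element of $\mathcal N_n(x)$ nearest to $Y_{i_0j_0}$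 (if the minimal distance is not attained, the nearest point of the closure of $\mathcal N_n(x)$; if $\mathcal N_n(x)=\emptyset$, put $m_n(x)=0$). An *edge curve* is a simple closed plane curve with a unit-speed parametrization $c$, periodic and injective on a period, that has a bounded second derivative except at finitely many corners (modulo the period). Here $c(t_0)$ is a *corner with angle* $\alpha\in(0,\pi)\cup(\pi,2\pi)$ if near $t_0$, except at $t_0$, $c$ has unit speed and a bounded second derivative, $b_l=\lim_{t\nearrow t_0}c'(t)$ and $b_r=\lim_{t\searrow t_0}c'(t)$ exist, and the rays from $c(t_0)$ in the directions $-b_l$ and $b_r$ bound a sector of angle $\alpha$ (either of the two sectors may be taken). A point of an edge curve is *regular* if the parametrization is differentiable there. **Assumptions.** * (A1) $f$ vanishes off an interval $\mathcal I$, $f$ is differentiable on $\mathbb R$ with Lipschitz continuous $f'$, and $f'(y)\ne0$ for all $y\in\mathcal I\setminus\{0\}$. * (A2) (A1), and $f$ vanishes off a bounded interval $(a_1,a_2)$ with $a_2-a_1<d$. * (A1') $f$ vanishes off an interval $\mathcal I\ni0$, is symmetric on $[-g,g]$, strictly decreasing on $(0,\infty)\cap\mathcal I$ and strictly increasing on $(-\infty,0)\cap\mathcal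 I$. * (A2') (A1'), and $f$ vanishes off $(-a,a)$ for some $a$ with $2a+2g<d$. * (B2) $m=\mu+d\,\mathbb 1_D$ with $\mu$ continuous on $[0,1]^2$, $d>0$, and $D\subset[0,1]^2$ nonempty and closed, whose boundary $\partial D$ in $\mathbb R^2$ is a disjoint union of finitely many edge curves. * (B3) $K\ge0$ on $(-1,1)^2$, $K=0$ elsewhere, $K$ is Lipschitz continuous, $K(0)>0$ and $\int K=1$. * (B4) $L\ge0$ has a Lipschitz continuous derivative, $L(0)\neq0$, $\int L=1$, and $L(v)|v|$ and $L'(v)|v|$ are integrable. * (B5) $g_n\to0$, $h_n\to0$, $n^{-1}h_n^{-2}\to0$ and $n^{-1}h_n^{-1}g_n^{-2}\to0$. * (B4') $L\ge0$ is twice differentiable with Lipschitz continuous $L'$ and $L''$, symmetric, zero off $(-1,1)$, $L'>0$ on $(-1,0)$, and $L''$ has finitely many zeros in $(-1,1)$. * (B5') $g_n=g>0$ is constant, $h_n\to0$ and $n^{-1}h_n^{-1}\to0$. (B) means (B2)–(B5), and (B') means (B2), (B3), (B4'), (B5'). **Theorem 1.** (a) Let (A1) and (B), or (A1') and (B'),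 hold. Then the M-smoother is consistent in smooth regions: for all $x_0\in(0,1)^2\setminus\partial D$ and all $\eta>0$, $\lim_{n\to\infty}P(|m_n(x_0)-m(x_0)|>\eta)=0$. (b) Let (A2) and (B), or (A2') and (B'), hold, and let $D$ be the closure of its interior. Then the M-smoother is corner-preserving for large samples: for every $x_0\in\partial D$ with rational coordinates that is a regular point, or a corner with some angle in $(0,\pi)\cup(\pi,2\pi)$, of an edge curve contained in $\partial D$, for every strictly increasing sequence $(n_l)$ such that $x_0$ is a pixel position of the $n_l\times n_l$ grid for every $l$, and for all $\eta>0$, $\lim_{l\to\infty}P(|m_{n_l}(x_0)-m(x_0)|>\eta)=0$. -/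

import Mathlib

open Set Filter Topology MeasureTheory ProbabilityTheory

/-- The plane with its Euclidean norm. -/
abbrev Plane : Type := EuclideanSpace ℝ (Fin 2)

/-! ### Edge curves, regular points and corner points -/

/-- At time `t` the curve `c` has a unit-speed (natural) parametrization and a second derivative
of norm at most `M`. -/
def NaturalAt (c : ℝ → Plane) (M t : ℝ) : Prop :=
  DifferentiableAt ℝ c t ∧ ‖deriv c t‖ = 1 ∧
    DifferentiableAt ℝ (deriv c) t ∧ ‖deriv (deriv c) t‖ ≤ M

/-- `c t₀` is a corner of the curve `c` with angle `α`: near `t₀`, except at `t₀` itself, the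
parametrization is natural with bounded second derivative, the one-sided limits `bl`, `br` of the
velocity exist, and the two directional tangents, that is the rays from `c t₀` in the directions
`-bl` and `br`, bound a sector of angle `α`, where `α` is neither `0` nor `π`.
The two rays bound two sectors; `α` may be the opening of either of them. -/
def IsCornerAt (c : ℝ → Plane) (t₀ α : ℝ) : Prop :=
  α ∈ Ioo 0 Real.pi ∪ Ioo Real.pi (2 * Real.pi) ∧
  (∃ δ > 0, ∃ M : ℝ, ∀ t, t ≠ t₀ → |t - t₀| < δ → NaturalAt c M t) ∧
  ∃ bl br : Plane,
    Tendsto (deriv c) (𝓝[<] t₀) (𝓝 bl) ∧ Tendsto (deriv c) (𝓝[>] t₀) (𝓝 br) ∧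
    (InnerProductGeometry.angle (-bl) br = α ∨
      InnerProductGeometry.angle (-bl) br = 2 * Real.pi - α)

/-- An edge curve of length `ℓ`: a simple closed curve, given as an `ℓ`-periodic map that is
injective on a period, with a natural parametrization and a bounded second derivative except at
finitely many corners. -/
structure IsEdgeCurve (c : ℝ → Plane) (ℓ : ℝ) : Prop where
  length_pos : 0 < ℓ
  continuous : Continuous c
  periodic : Function.Periodic c ℓ
  simple : InjOn c (Ico 0 ℓ)
  smooth_off_corners : ∃ (T : Set ℝ) (M : ℝ), T.Finite ∧ T ⊆ Ico 0 ℓ ∧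
    (∀ t ∈ Ico 0 ℓ \ T, NaturalAt c M t) ∧ ∀ t ∈ T, ∃ α, IsCornerAt c t α

/-- `x₀` is a regular point of the boundary of `D`: a point of an edge curve contained in `∂D`
at which the natural parametrization is differentiable. -/
def IsRegularEdgePoint (D : Set Plane) (x₀ : Plane) : Prop :=
  ∃ (c : ℝ → Plane) (ℓ t : ℝ), IsEdgeCurve c ℓ ∧ range c ⊆ frontier D ∧ c t = x₀ ∧
    DifferentiableAt ℝ c t

/-- `x₀` is a corner point with angle `α` of the boundary of `D`. -/
def IsCornerPoint (D : Set Plane) (x₀ : Plane) (α : ℝ) : Prop :=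
  ∃ (c : ℝ → Plane) (ℓ t : ℝ), IsEdgeCurve c ℓ ∧ range c ⊆ frontier D ∧ c t = x₀ ∧
    IsCornerAt c t α

/-! ### The pixel grid and the M-smoother -/

/-- The closed unit square. -/
def closedSquare : Set Plane := {x | ∀ k, x k ∈ Icc (0 : ℝ) 1}

/-- The open unit square. -/
def openSquare : Set Plane := {x | ∀ k, x k ∈ Ioo (0 : ℝ) 1}

/-- The pixel positions; as indices start at `0` here, the coordinates are `(i + 1/2) / n`. -/
noncomputable def pixel (n : ℕ) (i j : Fin n) : Plane :=
  !₂[((i : ℝ) + 1 / 2) / n, ((j : ℝ) + 1 / 2) / n]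

/-- `x` is one of the pixel positions of the `n × n` grid. -/
def IsGridPoint (n : ℕ) (x : Plane) : Prop := ∃ i j : Fin n, pixel n i j = x

/-- Both coordinates of `x` are rational. -/
def IsRationalPoint (x : Plane) : Prop := ∀ k, ∃ q : ℚ, (q : ℝ) = x k

/-- The pixel `(i₀, j₀)` is the one nearest to `x`; among equally near ones each index is
taken as small as possible. -/
def IsCentre (n : ℕ) (x : Plane) (i₀ j₀ : Fin n) : Prop :=
  (∀ i j, ‖x - pixel n i₀ j₀‖ ≤ ‖x - pixel n i j‖) ∧
  ∀ i j, ‖x - pixel n i j‖ = ‖x - pixel n i₀ j₀‖ → i₀ ≤ i ∧ j₀ ≤ j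

/-- The score function `H_{n,x}` with kernels `K`, `L`, bandwidths `h`, `g` and data `Y`. -/
noncomputable def score (K : Plane → ℝ) (L : ℝ → ℝ) (h g : ℝ) (n : ℕ) (Y : Fin n → Fin n → ℝ)
    (x : Plane) (y : ℝ) : ℝ :=
  1 / (n : ℝ) ^ 2 * ∑ i : Fin n, ∑ j : Fin n,
    (1 / h ^ 2 * K (h⁻¹ • (x - pixel n i j))) * (1 / g * L ((y - Y i j) / g))

/-- The local maxima of `H` lying in the direction of ascent from the starting value `y₀`. -/
def ascentMaxima (H : ℝ → ℝ) (y₀ : ℝ) : Set ℝ :=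
  {y | IsLocalMax H y ∧ (deriv H y₀ ≤ 0 → y ≤ y₀) ∧ (0 < deriv H y₀ → y₀ < y)}

/-- `y` is the point nearest to the central observation among the local maxima of the score
function in the direction of ascent. The closure only matters if the minimal distance is not
attained by a local maximum. -/
def IsMEstimate (K : Plane → ℝ) (L : ℝ → ℝ) (h g : ℝ) (n : ℕ) (Y : Fin n → Fin n → ℝ)
    (x : Plane) (y : ℝ) : Prop :=
  ∃ i₀ j₀ : Fin n, IsCentre n x i₀ j₀ ∧
    y ∈ closure (ascentMaxima (score K L h g n Y x) (Y i₀ j₀)) ∧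
    ∀ z ∈ closure (ascentMaxima (score K L h g n Y x) (Y i₀ j₀)), |y - Y i₀ j₀| ≤ |z - Y i₀ j₀|

open Classical in
/-- The M-smoother at `x` (with value `0` if there is no local maximum in the direction of
ascent). -/
noncomputable def mEstimate (K : Plane → ℝ) (L : ℝ → ℝ) (h g : ℝ) (n : ℕ)
    (Y : Fin n → Fin n → ℝ) (x : Plane) : ℝ :=
  if hy : ∃ y, IsMEstimate K L h g n Y x y then hy.choose else 0

/-! ### The model -/

/-- The true image `m = μ + d 1_D`. -/
noncomputable def trueImage (μ : Plane → ℝ) (d : ℝ) (D : Set Plane) (x : Plane) : ℝ :=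
  μ x + D.indicator (fun _ => d) x

/-- The M-smoother `m_n(x)` of the noisy image `Y_ij = m(x_ij) + ε_ij`. -/
noncomputable def mSmoother {Ω : Type*} (K : Plane → ℝ) (L : ℝ → ℝ) (h g : ℕ → ℝ)
    (m : Plane → ℝ) (ε : (n : ℕ) → Fin n → Fin n → Ω → ℝ) (n : ℕ) (x : Plane) (ω : Ω) : ℝ :=
  mEstimate K L (h n) (g n) n (fun i j => m (pixel n i j) + ε n i j ω) x

/-- For every `n` the errors `ε n i j` are independent and identically distributed with
probability density `f`. -/
structure IsIIDNoise {Ω : Type*} [MeasurableSpace Ω] (P : Measure Ω)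
    (ε : (n : ℕ) → Fin n → Fin n → Ω → ℝ) (f : ℝ → ℝ) : Prop where
  density_measurable : Measurable f
  density_nonneg : ∀ y, 0 ≤ f y
  measurable : ∀ n i j, Measurable (ε n i j)
  law : ∀ n i j, P.map (ε n i j) = volume.withDensity (fun y => ENNReal.ofReal (f y))
  indep : ∀ n, iIndepFun (fun p : Fin n × Fin n => ε n p.1 p.2) P

/-- The error density `f` has a Lipschitz derivative which does not vanish on the supporting interval
except possibly at `0`. -/
def AssumptionA1 (f : ℝ → ℝ) : Prop :=
  ∃ I : Set ℝ, I.OrdConnected ∧ (∀ y ∉ I, f y = 0) ∧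
    Differentiable ℝ f ∧ (∃ C, LipschitzWith C (deriv f)) ∧ ∀ y ∈ I, y ≠ 0 → deriv f y ≠ 0

/-- In addition the error density `f` is supported on an interval shorter than the jump height `d`. -/
def AssumptionA2 (d : ℝ) (f : ℝ → ℝ) : Prop :=
  AssumptionA1 f ∧ ∃ a₁ a₂ : ℝ, (∀ y ∉ Ioo a₁ a₂, f y = 0) ∧ a₂ - a₁ < d

/-- The error density `f` is unimodal with mode `0` and symmetric on `[-g, g]`. -/
def AssumptionA1' (g : ℝ) (f : ℝ → ℝ) : Prop :=
  ∃ I : Set ℝ, I.OrdConnected ∧ (0 : ℝ) ∈ I ∧ (∀ y ∉ I, f y = 0) ∧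
    (∀ y ∈ Icc (-g) g, f (-y) = f y) ∧
    StrictAntiOn f (Ioi 0 ∩ I) ∧ StrictMonoOn f (Iio 0 ∩ I)

/-- In addition the error density `f` is supported on `(-a, a)` with `2a + 2g < d`. -/
def AssumptionA2' (g d : ℝ) (f : ℝ → ℝ) : Prop :=
  AssumptionA1' g f ∧ ∃ a : ℝ, (∀ y ∉ Ioo (-a) a, f y = 0) ∧ 2 * a + 2 * g < d

/-- The shape of the image. The boundary of `D` is its boundary in the plane. -/
structure AssumptionB2 (μ : Plane → ℝ) (d : ℝ) (D : Set Plane) : Prop where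
  continuousOn : ContinuousOn μ closedSquare
  jump_pos : 0 < d
  nonempty : D.Nonempty
  isClosed : IsClosed D
  subset : D ⊆ closedSquare
  boundary : ∃ (N : ℕ) (c : Fin N → ℝ → Plane) (ℓ : Fin N → ℝ),
    (∀ k, IsEdgeCurve (c k) (ℓ k)) ∧ (Pairwise fun k l => Disjoint (range (c k)) (range (c l))) ∧
    frontier D = ⋃ k, range (c k)

/-- The spatial kernel `K`. -/
structure AssumptionB3 (K : Plane → ℝ) : Prop where
  nonneg : ∀ u : Plane, (∀ k, u k ∈ Ioo (-1 : ℝ) 1) → 0 ≤ K u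
  eq_zero : ∀ u : Plane, ¬ (∀ k, u k ∈ Ioo (-1 : ℝ) 1) → K u = 0
  lipschitz : ∃ C, LipschitzWith C K
  pos : 0 < K 0
  integral : ∫ u, K u = 1

/-- The score kernel `L` for vanishing scale parameter. -/
structure AssumptionB4 (L : ℝ → ℝ) : Prop where
  nonneg : ∀ v, 0 ≤ L v
  differentiable : Differentiable ℝ L
  lipschitz_deriv : ∃ C, LipschitzWith C (deriv L)
  ne_zero : L 0 ≠ 0
  integral : ∫ v, L v = 1
  integrable_mul_abs : Integrable fun v => L v * |v|
  integrable_deriv_mul_abs : Integrable fun v => deriv L v * |v|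

/-- The score kernel `L` for fixed scale parameter. -/
structure AssumptionB4' (L : ℝ → ℝ) : Prop where
  nonneg : ∀ v, 0 ≤ L v
  differentiable : Differentiable ℝ L
  differentiable_deriv : Differentiable ℝ (deriv L)
  lipschitz_deriv : ∃ C, LipschitzWith C (deriv L)
  lipschitz_deriv_deriv : ∃ C, LipschitzWith C (deriv (deriv L))
  symmetric : ∀ v, L (-v) = L v
  eq_zero : ∀ v ∉ Ioo (-1 : ℝ) 1, L v = 0
  deriv_pos : ∀ v ∈ Ioo (-1 : ℝ) 0, 0 < deriv L v
  finite_zeros : {v ∈ Ioo (-1 : ℝ) 1 | deriv (deriv L) v = 0}.Finite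

/-- The bandwidths for vanishing scale parameter. -/
structure AssumptionB5 (h g : ℕ → ℝ) : Prop where
  h_pos : ∀ n, 0 < h n
  g_pos : ∀ n, 0 < g n
  g_tendsto : Tendsto g atTop (𝓝 0)
  h_tendsto : Tendsto h atTop (𝓝 0)
  rate_h : Tendsto (fun n : ℕ => (n : ℝ)⁻¹ * (h n)⁻¹ ^ 2) atTop (𝓝 0)
  rate_g : Tendsto (fun n : ℕ => (n : ℝ)⁻¹ * (h n)⁻¹ * (g n)⁻¹ ^ 2) atTop (𝓝 0)

/-- The bandwidths for fixed scale parameter `g₀`. -/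
structure AssumptionB5' (h g : ℕ → ℝ) (g₀ : ℝ) : Prop where
  h_pos : ∀ n, 0 < h n
  g₀_pos : 0 < g₀
  g_const : ∀ n, g n = g₀
  h_tendsto : Tendsto h atTop (𝓝 0)
  rate_h : Tendsto (fun n : ℕ => (n : ℝ)⁻¹ * (h n)⁻¹) atTop (𝓝 0)

/-- All assumptions for vanishing scale parameter; the equidistant design is part of `pixel`. -/
def AssumptionB (μ : Plane → ℝ) (d : ℝ) (D : Set Plane) (K : Plane → ℝ) (L : ℝ → ℝ)
    (h g : ℕ → ℝ) : Prop :=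
  AssumptionB2 μ d D ∧ AssumptionB3 K ∧ AssumptionB4 L ∧ AssumptionB5 h g

/-- All assumptions for fixed scale parameter `g₀`. -/
def AssumptionB' (μ : Plane → ℝ) (d : ℝ) (D : Set Plane) (K : Plane → ℝ) (L : ℝ → ℝ)
    (h g : ℕ → ℝ) (g₀ : ℝ) : Prop :=
  AssumptionB2 μ d D ∧ AssumptionB3 K ∧ AssumptionB4' L ∧ AssumptionB5' h g g₀

/-! ### Consistency and corner preservation -/

section Consistency

variable {Ω : Type*} [MeasurableSpace Ω] (P : Measure Ω) (m : Plane → ℝ) (D : Set Plane)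
  (est : ℕ → Plane → Ω → ℝ)

/-- Consistency in probability at every point of the open square off `∂D`. -/
def ConsistentInSmoothRegions : Prop :=
  ∀ x₀ ∈ openSquare \ frontier D, ∀ η > 0,
    Tendsto (fun n => P {ω | η < |est n x₀ ω - m x₀|}) atTop (𝓝 0)

/-- Consistency in probability at `x₀` along every subsequence of grids that contain `x₀`. -/
def ConsistentAlongGrids (x₀ : Plane) : Prop :=
  ∀ s : ℕ → ℕ, StrictMono s → (∀ l, IsGridPoint (s l) x₀) → ∀ η > 0,
    Tendsto (fun l => P {ω | η < |est (s l) x₀ ω - m x₀|}) atTop (𝓝 0)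

/-- Edge-preserving for large samples. -/
def EdgePreserving : Prop :=
  ∀ x₀ ∈ frontier D, IsRationalPoint x₀ → IsRegularEdgePoint D x₀ →
    ConsistentAlongGrids P m est x₀

/-- `α`-corner-preserving for large samples. -/
def AngleCornerPreserving (α : ℝ) : Prop :=
  ∀ x₀ ∈ frontier D, IsRationalPoint x₀ →
    (∃ β ∈ Ioo α Real.pi ∪ Ioo Real.pi (2 * Real.pi), IsCornerPoint D x₀ β) →
    ConsistentAlongGrids P m est x₀

/-- Corner-preserving for large samples. -/
def CornerPreserving : Prop :=
  EdgePreserving P m D est ∧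
    ∀ α ∈ Ioo 0 Real.pi ∪ Ioo Real.pi (2 * Real.pi), AngleCornerPreserving P m D est α

end Consistency

/-!
The M-smoother climbs from the central observation to the nearest local maximum of the score, so it
is consistent once the slope of the score has the right sign on the whole way from a typical start
value to a small neighbourhood of the true value. Only start values inside a compact subset of the
carrier of the noise matter, and `abs_mEstimate_sub_le` then turns the sign pattern into a bound
for the estimate.

The sign pattern comes from a uniform limit. The mean slope of the score at `y` is a weighted sum,
over the pixels, of the expected slopes `meanSlope` at `y - m(x_ij)`; these converge to a Lipschitz
function `φ`, which is the derivative `f'` of the error density when the scale parameter vanishes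
(integrate by parts) and the derivative of the density smoothed by `L` when it is fixed. In both
cases `φ` is positive to the left and negative to the right of `0` on the carrier of the noise: a
density without critical points other than `0` has a single peak there, and smoothing by an even
unimodal kernel keeps the peak of a density that is symmetric on the window. The structure
`IsLimitSlope` records what the rest of the argument needs from either set of assumptions.

The random slope is uniformly close to its mean (`IsLimitSlope.tendsto_measure_slopeDeviation`): by
a Bernstein inequality each single deviation has probability at most `exp(-c (n h)² g³)`, and as
the slope has a Lipschitz constant of order `g⁻³`, a union bound over about `g⁻³` points suffices.
The rate conditions make the product vanish: for `g → 0`, `n h g² → ∞` gives `(n h)² g³ ≥ 1 / g`,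
and for fixed `g`, `n h → ∞` is enough.

At a point off the boundary the weights concentrate where the image is nearly constant. At a
boundary point the mean slope is close to `λ φ(z) + (1 - λ) φ(z + d)`, where `λ` is the weight of
the pixels in `D`; the second term vanishes for `z` in the carrier of the noise by the support
condition, so it remains to bound `λ` from below. Each boundary point lies on one of the given edge
curves, and since its angle there is not `0`, the curve is a Lipschitz graph over the direction of
the sum of its one-sided velocities. As `D` is the closure of its interior, it contains the cone on
one side of this graph (`AssumptionB2.exists_ball_subset`), and a Riemann sum of a tent function
supported in that cone bounds `λ`.
-/

/-! ### Ascending to the nearest local maximum -/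

/-- A strictly positive slope at the left end and a strictly negative slope at the right end
force an interior local maximum. -/
theorem exists_isLocalMax_of_deriv_sign {H : ℝ → ℝ} {a b : ℝ} (hab : a ≤ b)
    (hH : Differentiable ℝ H) (ha : 0 < deriv H a) (hb : deriv H b < 0) :
    ∃ p ∈ Ioo a b, IsLocalMax H p := by
  obtain ⟨p, hp, hmax⟩ := isCompact_Icc.exists_isMaxOn (nonempty_Icc.2 hab)
    hH.continuous.continuousOn
  have hlt : a < b := by
    rcases hab.eq_or_lt with h | h
    · subst h; linarith
    · exact h
  have hpa : p ≠ a := by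
    rintro rfl
    have h1 : ∀ᶠ x in 𝓝[>] p, 0 < slope H p x :=
      ((hasDerivAt_iff_tendsto_slope.1 (hH p).hasDerivAt).mono_left
        (nhdsWithin_mono _ fun x hx => ne_of_gt hx)).eventually (lt_mem_nhds ha)
    obtain ⟨x, hx1, hx2⟩ := (h1.and (Ioo_mem_nhdsGT hlt)).exists
    rw [slope_def_field] at hx1
    have h2 : H x ≤ H p := hmax ⟨hx2.1.le, hx2.2.le⟩
    have := div_nonpos_of_nonpos_of_nonneg (sub_nonpos.2 h2) (sub_pos.2 hx2.1).le
    linarith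
  have hpb : p ≠ b := by
    rintro rfl
    have h1 : ∀ᶠ x in 𝓝[<] p, slope H p x < 0 :=
      ((hasDerivAt_iff_tendsto_slope.1 (hH p).hasDerivAt).mono_left
        (nhdsWithin_mono _ fun x hx => ne_of_lt hx)).eventually (gt_mem_nhds hb)
    obtain ⟨x, hx1, hx2⟩ := (h1.and (Ioo_mem_nhdsLT hlt)).exists
    rw [slope_def_field] at hx1
    have h2 : H x ≤ H p := hmax ⟨hx2.1.le, hx2.2.le⟩
    have := div_nonneg_of_nonpos (sub_nonpos.2 h2) (sub_neg.2 hx2.2).le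
    linarith
  have hp' : p ∈ Ioo a b := ⟨lt_of_le_of_ne hp.1 hpa.symm, lt_of_le_of_ne hp.2 hpb⟩
  exact ⟨p, hp', hmax.isLocalMax (Icc_mem_nhds hp'.1 hp'.2)⟩

theorem IsCentre.unique {n : ℕ} {x : Plane} {i j i' j' : Fin n} (h : IsCentre n x i j)
    (h' : IsCentre n x i' j') : i = i' ∧ j = j' := by
  have e : ‖x - pixel n i j‖ = ‖x - pixel n i' j'‖ := le_antisymm (h.1 _ _) (h'.1 _ _)
  have h1 := h.2 i' j' e.symm
  have h2 := h'.2 i j e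
  exact ⟨le_antisymm h1.1 h2.1, le_antisymm h1.2 h2.2⟩

theorem norm_sub_pixel_sq (n : ℕ) (x : Plane) (i j : Fin n) :
    ‖x - pixel n i j‖ ^ 2 =
      (x 0 - ((i : ℝ) + 1 / 2) / n) ^ 2 + (x 1 - ((j : ℝ) + 1 / 2) / n) ^ 2 := by
  rw [EuclideanSpace.norm_sq_eq]
  simp [pixel, Fin.sum_univ_two]

/-- The least index among those minimizing a function on a nonempty finite chain. -/
theorem exists_least_minimizer {n : ℕ} (hn : 0 < n) (F : Fin n → ℝ) :
    ∃ i, (∀ k, F i ≤ F k) ∧ ∀ k, F k = F i → i ≤ k := by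
  have : Nonempty (Fin n) := ⟨⟨0, hn⟩⟩
  obtain ⟨k, hk⟩ := Finite.exists_min F
  obtain ⟨i, hi, hmin⟩ := (Finset.univ.filter fun i => F i = F k).exists_minimal ⟨k, by simp⟩
  simp only [Finset.mem_filter, Finset.mem_univ, true_and] at hi hmin
  refine ⟨i, fun l => hi ▸ hk l, fun l hl => ?_⟩
  rcases le_total i l with h | h
  · exact h
  · exact hmin (hl.trans hi) h

theorem exists_isCentre {n : ℕ} (hn : 0 < n) (x : Plane) : ∃ i j, IsCentre n x i j := by
  obtain ⟨i, hi, hi'⟩ :=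
    exists_least_minimizer hn fun i : Fin n => (x 0 - ((i : ℝ) + 1 / 2) / n) ^ 2
  obtain ⟨j, hj, hj'⟩ :=
    exists_least_minimizer hn fun j : Fin n => (x 1 - ((j : ℝ) + 1 / 2) / n) ^ 2
  refine ⟨i, j, fun k l => ?_, fun k l hkl => ?_⟩
  · rw [← sq_le_sq₀ (norm_nonneg _) (norm_nonneg _), norm_sub_pixel_sq, norm_sub_pixel_sq]
    exact add_le_add (hi k) (hj l)
  · have h2 : ‖x - pixel n k l‖ ^ 2 = ‖x - pixel n i j‖ ^ 2 := by rw [hkl]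
    rw [norm_sub_pixel_sq, norm_sub_pixel_sq] at h2
    have h3 := hi k
    have h4 := hj l
    exact ⟨hi' k (by linarith), hj' l (by linarith)⟩

/-- A point nearest to the start value exists in the closure of a nonempty set of admissible
maxima, so `mEstimate` is then a genuine M-estimate. -/
theorem mEstimate_spec {K : Plane → ℝ} {L : ℝ → ℝ} {h g : ℝ} {n : ℕ} {Y : Fin n → Fin n → ℝ}
    {x : Plane} {i₀ j₀ : Fin n} (hc : IsCentre n x i₀ j₀)
    (hne : (ascentMaxima (score K L h g n Y x) (Y i₀ j₀)).Nonempty) :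
    mEstimate K L h g n Y x ∈ closure (ascentMaxima (score K L h g n Y x) (Y i₀ j₀)) ∧
      ∀ z ∈ closure (ascentMaxima (score K L h g n Y x) (Y i₀ j₀)),
        |mEstimate K L h g n Y x - Y i₀ j₀| ≤ |z - Y i₀ j₀| := by
  have hex : ∃ y, IsMEstimate K L h g n Y x y := by
    obtain ⟨y, hy, hd⟩ := isClosed_closure.exists_infDist_eq_dist hne.closure (Y i₀ j₀)
    refine ⟨y, i₀, j₀, hc, hy, fun z hz => ?_⟩
    have := Metric.infDist_le_dist_of_mem (x := Y i₀ j₀) hz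
    rw [hd, dist_comm, Real.dist_eq, dist_comm, Real.dist_eq] at this
    exact this
  have hspec : IsMEstimate K L h g n Y x (mEstimate K L h g n Y x) := by
    rw [mEstimate, dif_pos hex]; exact hex.choose_spec
  obtain ⟨i, j, hij, h1, h2⟩ := hspec
  obtain ⟨rfl, rfl⟩ := hij.unique hc
  exact ⟨h1, h2⟩

/-- If the score descends from the start value down to the `r`-neighbourhood of `m₀`, seen from
the start value, and increases towards `m₀` at both ends of that neighbourhood, then the
M-estimate is within `r` of `m₀`. -/
theorem abs_mEstimate_sub_le {K : Plane → ℝ} {L : ℝ → ℝ} {h g : ℝ} {n : ℕ}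
    {Y : Fin n → Fin n → ℝ} {x : Plane} {i₀ j₀ : Fin n} (hc : IsCentre n x i₀ j₀) {m₀ r : ℝ}
    (hr : 0 ≤ r) (hH : Differentiable ℝ (score K L h g n Y x))
    (hl : 0 < deriv (score K L h g n Y x) (m₀ - r))
    (hu : deriv (score K L h g n Y x) (m₀ + r) < 0)
    (hstart : (m₀ + r ≤ Y i₀ j₀ ∧
        ∀ y ∈ Icc (m₀ + r) (Y i₀ j₀), deriv (score K L h g n Y x) y < 0) ∨
      (Y i₀ j₀ ≤ m₀ - r ∧ ∀ y ∈ Icc (Y i₀ j₀) (m₀ - r), 0 < deriv (score K L h g n Y x) y)) :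
    |mEstimate K L h g n Y x - m₀| ≤ r := by
  obtain ⟨p, hp, hpm⟩ := exists_isLocalMax_of_deriv_sign (by linarith) hH hl hu
  have key := fun hne => mEstimate_spec (K := K) (L := L) (h := h) (g := g) (Y := Y) hc hne
  set H := score K L h g n Y x
  set y₀ := Y i₀ j₀
  rcases hstart with ⟨h1, h2⟩ | ⟨h1, h2⟩
  · have hd : deriv H y₀ < 0 := h2 _ ⟨h1, le_rfl⟩
    have hpS : p ∈ ascentMaxima H y₀ :=
      ⟨hpm, fun _ => by linarith [hp.2], fun h => absurd h (by linarith)⟩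
    have hsub : closure (ascentMaxima H y₀) ⊆ Iic (m₀ + r) := by
      refine closure_minimal (fun y hy => ?_) isClosed_Iic
      by_contra hcon
      have := h2 y ⟨(not_le.1 hcon).le, hy.2.1 hd.le⟩
      rw [hy.1.deriv_eq_zero] at this
      exact lt_irrefl _ this
    obtain ⟨k1, k2⟩ := key ⟨p, hpS⟩
    have k3 := k2 p (subset_closure hpS)
    have k4 : mEstimate K L h g n Y x ≤ m₀ + r := hsub k1
    rw [abs_of_nonpos (by linarith), abs_of_nonpos (by linarith [hp.2])] at k3
    rw [abs_le]; constructor <;> linarith [hp.1]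
  · have hd : 0 < deriv H y₀ := h2 _ ⟨le_rfl, h1⟩
    have hpS : p ∈ ascentMaxima H y₀ :=
      ⟨hpm, fun h => absurd h (by linarith), fun _ => by linarith [hp.1]⟩
    have hsub : closure (ascentMaxima H y₀) ⊆ Ici (m₀ - r) := by
      refine closure_minimal (fun y hy => ?_) isClosed_Ici
      by_contra hcon
      have := h2 y ⟨(hy.2.2 hd).le, (not_le.1 hcon).le⟩
      rw [hy.1.deriv_eq_zero] at this
      exact lt_irrefl _ this
    obtain ⟨k1, k2⟩ := key ⟨p, hpS⟩
    have k3 := k2 p (subset_closure hpS)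
    have k4 : m₀ - r ≤ mEstimate K L h g n Y x := hsub k1
    rw [abs_of_nonneg (by linarith), abs_of_nonneg (by linarith [hp.1])] at k3
    rw [abs_le]; constructor <;> linarith [hp.2]

/-! ### Riemann sums over the pixel grid -/

/-- The half-open square of side `1 / n` centred at a pixel. -/
def cell (n : ℕ) (p : Fin n × Fin n) : Set Plane :=
  {x | x 0 ∈ Ico ((p.1 : ℝ) / n) (((p.1 : ℝ) + 1) / n) ∧
    x 1 ∈ Ico ((p.2 : ℝ) / n) (((p.2 : ℝ) + 1) / n)}

theorem cell_eq_preimage (n : ℕ) (p : Fin n × Fin n) :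
    cell n p = (WithLp.ofLp : Plane → Fin 2 → ℝ) ⁻¹' univ.pi fun k =>
      Ico ((![(p.1 : ℝ), (p.2 : ℝ)] k) / n) ((![(p.1 : ℝ), (p.2 : ℝ)] k + 1) / n) := by
  ext x
  simp [cell, Fin.forall_fin_two]

theorem measurableSet_cell (n : ℕ) (p : Fin n × Fin n) : MeasurableSet (cell n p) := by
  rw [cell_eq_preimage]
  exact (PiLp.volume_preserving_ofLp (Fin 2)).measurable
    (MeasurableSet.univ_pi fun _ => measurableSet_Ico)

theorem volume_cell (n : ℕ) (p : Fin n × Fin n) :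
    volume (cell n p) = ENNReal.ofReal (1 / (n : ℝ) ^ 2) := by
  rw [cell_eq_preimage, (PiLp.volume_preserving_ofLp (Fin 2)).measure_preimage
    (MeasurableSet.univ_pi fun _ => measurableSet_Ico).nullMeasurableSet, Real.volume_pi_Ico]
  simp only [← sub_div, add_sub_cancel_left, Finset.prod_const, Finset.card_univ, Fintype.card_fin]
  rw [← ENNReal.ofReal_pow (by positivity)]
  congr 1
  field_simp

theorem pairwise_disjoint_cell (n : ℕ) : Pairwise (Function.onFun Disjoint (cell n)) := by
  rcases Nat.eq_zero_or_pos n with rfl | hn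
  · intro p; exact p.1.elim0
  have hn' : (0 : ℝ) < n := by exact_mod_cast hn
  have key : ∀ (i i' : Fin n) (t : ℝ), t ∈ Ico ((i : ℝ) / n) (((i : ℝ) + 1) / n) →
      t ∈ Ico ((i' : ℝ) / n) (((i' : ℝ) + 1) / n) → i = i' := by
    intro i i' t h h'
    have h1 : (i : ℝ) < i' + 1 := by
      have := h.1.trans_lt h'.2
      rwa [div_lt_div_iff_of_pos_right hn'] at this
    have h2 : (i' : ℝ) < i + 1 := by
      have := h'.1.trans_lt h.2
      rwa [div_lt_div_iff_of_pos_right hn'] at this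
    norm_cast at h1 h2
    ext; omega
  intro p q hpq
  refine Set.disjoint_left.2 fun x hx hx' => hpq ?_
  exact Prod.ext (key _ _ _ hx.1 hx'.1) (key _ _ _ hx.2 hx'.2)

theorem exists_mem_cell {n : ℕ} (hn : 0 < n) {x : Plane} (hx : x ∈ openSquare) :
    ∃ p, x ∈ cell n p := by
  have hn' : (0 : ℝ) < n := by exact_mod_cast hn
  have key : ∀ k, ∃ i : Fin n, x k ∈ Ico ((i : ℝ) / n) (((i : ℝ) + 1) / n) := by
    intro k
    obtain ⟨h0, h1⟩ := hx k
    refine ⟨⟨⌊x k * n⌋₊, ?_⟩, ?_, ?_⟩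
    · rw [Nat.floor_lt (by positivity)]; nlinarith
    · rw [div_le_iff₀ hn']; exact Nat.floor_le (by positivity)
    · rw [lt_div_iff₀ hn']; exact Nat.lt_floor_add_one _
  obtain ⟨i, hi⟩ := key 0
  obtain ⟨j, hj⟩ := key 1
  exact ⟨(i, j), hi, hj⟩

theorem norm_le_abs_add_abs (x : Plane) : ‖x‖ ≤ |x 0| + |x 1| := by
  rw [← sq_le_sq₀ (norm_nonneg _) (by positivity), EuclideanSpace.norm_sq_eq]
  simp only [Real.norm_eq_abs, sq_abs, Fin.sum_univ_two]
  nlinarith [abs_nonneg (x 0), abs_nonneg (x 1), sq_abs (x 0), sq_abs (x 1)]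

theorem norm_sub_pixel_le {n : ℕ} {p : Fin n × Fin n} {x : Plane} (hx : x ∈ cell n p) :
    ‖x - pixel n p.1 p.2‖ ≤ 1 / n := by
  have hn' : (0 : ℝ) < n := by exact_mod_cast p.1.pos
  have key : ∀ a t : ℝ, t ∈ Ico (a / n) ((a + 1) / n) → |t - (a + 1 / 2) / n| ≤ 1 / 2 / n := by
    intro a t ht
    have h1 := ht.1
    have h2 := ht.2.le
    have e1 : (a + 1 / 2) / n = a / n + 1 / 2 / n := by ring
    have e2 : (a + 1) / n = a / n + 1 / 2 / n + 1 / 2 / n := by ring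
    rw [e2] at h2
    rw [e1, abs_le]
    constructor <;> linarith
  refine (norm_le_abs_add_abs _).trans ?_
  have h1 := key _ _ hx.1
  have h2 := key _ _ hx.2
  simp only [pixel, PiLp.sub_apply]
  calc _ ≤ 1 / 2 / (n : ℝ) + 1 / 2 / n := add_le_add (by simpa using h1) (by simpa using h2)
    _ = 1 / n := by ring

theorem isOpen_openSquare : IsOpen openSquare := by
  have : openSquare = ⋂ k : Fin 2, (fun x : Plane => x k) ⁻¹' Ioo 0 1 := by
    ext x; simp [openSquare]
  rw [this]
  exact isOpen_iInter_of_finite fun k => isOpen_Ioo.preimage (by fun_prop)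

theorem openSquare_subset_closedSquare : openSquare ⊆ closedSquare :=
  fun _ hx k => Ioo_subset_Icc_self (hx k)

theorem pixel_mem_openSquare {n : ℕ} (i j : Fin n) : pixel n i j ∈ openSquare := by
  have hn' : (0 : ℝ) < n := by exact_mod_cast i.pos
  have key : ∀ i : Fin n, ((i : ℝ) + 1 / 2) / n ∈ Ioo (0 : ℝ) 1 := by
    intro i
    have : (i : ℝ) + 1 ≤ n := by exact_mod_cast i.2
    exact ⟨by positivity, by rw [div_lt_one hn']; linarith⟩
  intro k
  fin_cases k
  · simpa [pixel] using key i
  · simpa [pixel] using key j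

/-- The Riemann sum over the pixels approximating `∫ ψ`, after rescaling by `h` around `x₀`. -/
noncomputable def riemannSum (ψ : Plane → ℝ) (h : ℝ) (n : ℕ) (x₀ : Plane) : ℝ :=
  ∑ p : Fin n × Fin n, 1 / (n : ℝ) ^ 2 * (1 / h ^ 2 * ψ (h⁻¹ • (x₀ - pixel n p.1 p.2)))

theorem integral_rescale (ψ : Plane → ℝ) {h : ℝ} (hh : 0 < h) (x₀ : Plane) :
    ∫ x, 1 / h ^ 2 * ψ (h⁻¹ • (x₀ - x)) = ∫ u, ψ u := by
  rw [integral_const_mul, integral_sub_left_eq_self (fun x => ψ (h⁻¹ • x)) volume x₀,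
    Measure.integral_comp_smul]
  simp only [finrank_euclideanSpace, Fintype.card_fin, smul_eq_mul]
  rw [abs_of_pos (by positivity)]
  field_simp

theorem abs_riemannSum_sub_integral_le {ψ : Plane → ℝ} {C : NNReal} (hψ : LipschitzWith C ψ)
    (hsupp : ∀ u, 2 ≤ ‖u‖ → ψ u = 0) {x₀ : Plane} {r h : ℝ} {n : ℕ}
    (hball : Metric.ball x₀ r ⊆ openSquare) (hn : 0 < n) (hh : 0 < h) (hr : 2 * h ≤ r)
    (hnh : 1 / (n : ℝ) ≤ h) :
    |riemannSum ψ h n x₀ - ∫ u, ψ u| ≤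
      C * (9 * volume.real (Metric.ball (0 : Plane) 1)) / (n * h) := by
  have hn' : (0 : ℝ) < n := by exact_mod_cast hn
  set G : Plane → ℝ := fun x => 1 / h ^ 2 * ψ (h⁻¹ • (x₀ - x)) with hG
  have hGcont : Continuous G := by
    have := hψ.continuous
    fun_prop
  have hGzero : ∀ x, 2 * h ≤ ‖x - x₀‖ → G x = 0 := by
    intro x hx
    have : ψ (h⁻¹ • (x₀ - x)) = 0 := by
      apply hsupp
      rw [norm_smul, norm_inv, Real.norm_of_nonneg hh.le, norm_sub_rev, inv_mul_eq_div,
        le_div_iff₀ hh]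
      exact hx
    simp [hG, this]
  have hGint : Integrable G := by
    refine hGcont.integrable_of_hasCompactSupport ?_
    refine HasCompactSupport.of_support_subset_isCompact (isCompact_closedBall x₀ (2 * h)) ?_
    intro x hx
    rw [mem_closedBall_iff_norm]
    by_contra hcon
    exact hx (hGzero x (not_le.1 hcon).le)
  have hGlip : ∀ x y, |G x - G y| ≤ 1 / h ^ 2 * (C * (h⁻¹ * ‖x - y‖)) := by
    intro x y
    have h1 := hψ.dist_le_mul (h⁻¹ • (x₀ - x)) (h⁻¹ • (x₀ - y))
    rw [dist_eq_norm, dist_eq_norm, ← smul_sub, norm_smul, norm_inv, Real.norm_of_nonneg hh.le,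
      sub_sub_sub_cancel_left, norm_sub_rev y x, Real.norm_eq_abs] at h1
    simp only [hG]
    rw [← mul_sub, abs_mul, abs_of_pos (by positivity : (0 : ℝ) < 1 / h ^ 2)]
    exact mul_le_mul_of_nonneg_left h1 (by positivity)
  set c : ℝ := 1 / h ^ 2 * (C * (h⁻¹ * (1 / n))) with hc
  have hc0 : 0 ≤ c := by positivity
  set B := Metric.ball x₀ (3 * h) with hB
  have hBm : MeasurableSet B := Metric.isOpen_ball.measurableSet
  have hcB : Integrable (B.indicator fun _ => c) := by
    refine (integrable_indicator_iff hBm).2 (integrableOn_const (by finiteness))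
  have hcell : ∀ p : Fin n × Fin n, ∀ x ∈ cell n p,
      |G (pixel n p.1 p.2) - G x| ≤ B.indicator (fun _ => c) x := by
    intro p x hx
    have hpx := norm_sub_pixel_le hx
    by_cases hxB : x ∈ B
    · rw [indicator_of_mem hxB]
      refine (hGlip _ _).trans ?_
      rw [norm_sub_rev]
      rw [hc]
      gcongr
    · rw [indicator_of_notMem hxB]
      rw [hB, mem_ball_iff_norm, not_lt] at hxB
      rw [hGzero x (by linarith), hGzero, sub_zero, abs_zero]
      have := norm_sub_le_norm_sub_add_norm_sub x (pixel n p.1 p.2) x₀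
      linarith
  have hfin : ∀ p : Fin n × Fin n, volume (cell n p) ≠ ⊤ := fun p => by
    rw [volume_cell]; exact ENNReal.ofReal_ne_top
  have hint : ∫ u, ψ u = ∑ p : Fin n × Fin n, ∫ x in cell n p, G x := by
    rw [← integral_rescale ψ hh x₀,
      ← integral_iUnion_fintype (measurableSet_cell n) (pairwise_disjoint_cell n)
        fun p => hGint.integrableOn]
    refine (setIntegral_eq_integral_of_forall_compl_eq_zero fun x hx => hGzero x ?_).symm
    by_contra hcon
    have hxs : x ∈ openSquare := hball (by rw [mem_ball_iff_norm]; linarith)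
    exact hx (mem_iUnion.2 (exists_mem_cell hn hxs))
  have hsum : riemannSum ψ h n x₀ = ∑ p : Fin n × Fin n, ∫ _ in cell n p, G (pixel n p.1 p.2) := by
    refine Finset.sum_congr rfl fun p _ => ?_
    rw [setIntegral_const, Measure.real, volume_cell, ENNReal.toReal_ofReal (by positivity),
      smul_eq_mul]
  rw [hint, hsum, ← Finset.sum_sub_distrib]
  calc _ ≤ ∑ p : Fin n × Fin n, ∫ x in cell n p, B.indicator (fun _ => c) x := by
        refine (Finset.abs_sum_le_sum_abs _ _).trans (Finset.sum_le_sum fun p _ => ?_)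
        have hci : Integrable (fun _ => G (pixel n p.1 p.2)) (volume.restrict (cell n p)) :=
          integrableOn_const (hfin p)
        rw [← integral_sub hci hGint.integrableOn]
        refine (abs_integral_le_integral_abs).trans ?_
        refine setIntegral_mono_on ?_ hcB.integrableOn (measurableSet_cell n p) (hcell p)
        exact (hci.sub hGint.integrableOn).abs
    _ = ∫ x in ⋃ p, cell n p, B.indicator (fun _ => c) x :=
        (integral_iUnion_fintype (measurableSet_cell n) (pairwise_disjoint_cell n)
          fun p => hcB.integrableOn).symm
    _ ≤ ∫ x, B.indicator (fun _ => c) x :=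
        setIntegral_le_integral hcB
          (Eventually.of_forall fun x => indicator_nonneg (fun _ _ => hc0) x)
    _ = C * (9 * volume.real (Metric.ball (0 : Plane) 1)) / (n * h) := by
        rw [integral_indicator hBm, setIntegral_const, Measure.real, hB,
          Measure.addHaar_ball volume x₀ (by positivity), ENNReal.toReal_mul,
          ENNReal.toReal_ofReal (by positivity)]
        simp only [finrank_euclideanSpace, Fintype.card_fin, smul_eq_mul, Measure.real, hc]
        field_simp
        ring

/-- Riemann sums of a Lipschitz kernel converge to its integral as soon as the window shrinks while
the number of pixels in it tends to infinity. -/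
theorem tendsto_riemannSum {ψ : Plane → ℝ} {C : NNReal} (hψ : LipschitzWith C ψ)
    (hsupp : ∀ u, 2 ≤ ‖u‖ → ψ u = 0) {x₀ : Plane} (hx₀ : x₀ ∈ openSquare) {h : ℕ → ℝ}
    (hpos : ∀ n, 0 < h n) (hh : Tendsto h atTop (𝓝 0))
    (hnh : Tendsto (fun n : ℕ => (n : ℝ) * h n) atTop atTop) :
    Tendsto (fun n => riemannSum ψ (h n) n x₀) atTop (𝓝 (∫ u, ψ u)) := by
  obtain ⟨r, hr, hball⟩ := Metric.isOpen_iff.1 isOpen_openSquare x₀ hx₀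
  rw [tendsto_iff_norm_sub_tendsto_zero]
  refine squeeze_zero' (Eventually.of_forall fun _ => norm_nonneg _) ?_
    (hnh.const_div_atTop (C * (9 * volume.real (Metric.ball (0 : Plane) 1))))
  filter_upwards [hh.eventually (gt_mem_nhds (half_pos hr)), hnh.eventually_ge_atTop 1,
    eventually_gt_atTop 0] with n h1 h2 h3
  refine abs_riemannSum_sub_integral_le hψ hsupp hball h3 (hpos n) (by linarith) ?_
  have : (0 : ℝ) < n := by exact_mod_cast h3
  rw [div_le_iff₀ this]; linarith

/-! ### An exponential inequality for the slope of the score -/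

section Bernstein

variable {Ω ι : Type*} [MeasurableSpace Ω] {P : Measure Ω} [IsProbabilityMeasure P] [Fintype ι]

theorem mgf_le_exp_of_bounded {X : Ω → ℝ} (hm : Measurable X) {B t : ℝ} (hbd : ∀ ω, |X ω| ≤ B)
    (hmean : ∫ ω, X ω ∂P = 0) (ht : 0 ≤ t) (htB : t * B ≤ 1) :
    mgf X P t ≤ Real.exp (t ^ 2 * ∫ ω, X ω ^ 2 ∂P) := by
  have hX : Integrable X P := Integrable.of_bound hm.aestronglyMeasurable B
    (Eventually.of_forall fun ω => by simpa using hbd ω)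
  have hX2 : Integrable (fun ω => X ω ^ 2) P :=
    Integrable.of_bound (hm.pow_const 2).aestronglyMeasurable (B ^ 2)
      (Eventually.of_forall fun ω => by
        rw [Real.norm_eq_abs, abs_pow]; exact pow_le_pow_left₀ (abs_nonneg _) (hbd ω) 2)
  have hle : ∀ ω, Real.exp (t * X ω) ≤ 1 + t * X ω + t ^ 2 * X ω ^ 2 := by
    intro ω
    have h1 : |t * X ω| ≤ 1 := by
      rw [abs_mul, abs_of_nonneg ht]
      exact (mul_le_mul_of_nonneg_left (hbd ω) ht).trans htB
    have h2 := (abs_le.1 (Real.abs_exp_sub_one_sub_id_le h1)).2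
    nlinarith
  have hi2 : Integrable (fun ω => 1 + t * X ω) P := (integrable_const _).add (hX.const_mul t)
  have hi : Integrable (fun ω => 1 + t * X ω + t ^ 2 * X ω ^ 2) P := hi2.add (hX2.const_mul _)
  calc mgf X P t ≤ ∫ ω, (1 + t * X ω + t ^ 2 * X ω ^ 2) ∂P :=
        integral_mono_of_nonneg (Eventually.of_forall fun ω => (Real.exp_pos _).le) hi
          (Eventually.of_forall hle)
    _ = t ^ 2 * (∫ ω, X ω ^ 2 ∂P) + 1 := by
        rw [integral_add hi2 (hX2.const_mul _), integral_add (integrable_const _) (hX.const_mul t),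
          integral_const_mul, integral_const_mul, hmean]
        simp; ring
    _ ≤ _ := Real.add_one_le_exp _

/-- A Bernstein-type bound; the free parameter `t` may be as large as the reciprocal of the bound
on the summands. -/
theorem measureReal_sum_ge_le_exp {X : ι → Ω → ℝ} (hindep : iIndepFun X P)
    (hm : ∀ i, Measurable (X i)) {B S t : ℝ} (hbd : ∀ i ω, |X i ω| ≤ B)
    (hmean : ∀ i, ∫ ω, X i ω ∂P = 0) (hvar : ∑ i, ∫ ω, X i ω ^ 2 ∂P ≤ S) (ht : 0 ≤ t)
    (htB : t * B ≤ 1) (κ : ℝ) :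
    P.real {ω | κ ≤ ∑ i, X i ω} ≤ Real.exp (-(t * κ) + t ^ 2 * S) := by
  have hsm : Measurable (fun ω => ∑ i, X i ω) := Finset.measurable_sum _ fun i _ => hm i
  have hint : Integrable (fun ω => Real.exp (t * ∑ i, X i ω)) P := by
    refine Integrable.of_bound (hsm.const_mul t).exp.aestronglyMeasurable
      (Real.exp (t * ∑ _i : ι, B)) (Eventually.of_forall fun ω => ?_)
    rw [Real.norm_of_nonneg (Real.exp_pos _).le]
    exact Real.exp_le_exp.2 (mul_le_mul_of_nonneg_left
      (Finset.sum_le_sum fun i _ => (le_abs_self _).trans (hbd i ω)) ht)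
  refine (measure_ge_le_exp_mul_mgf κ ht hint).trans ?_
  have hmgf : mgf (fun ω => ∑ i, X i ω) P t ≤ Real.exp (t ^ 2 * S) := by
    have h1 := hindep.mgf_sum (t := t) hm Finset.univ
    have h2 : (∑ i, X i) = fun ω => ∑ i, X i ω := by ext ω; simp
    rw [h2] at h1
    rw [h1]
    calc _ ≤ ∏ i, Real.exp (t ^ 2 * ∫ ω, X i ω ^ 2 ∂P) :=
          Finset.prod_le_prod (fun i _ => mgf_nonneg)
            fun i _ => mgf_le_exp_of_bounded (hm i) (hbd i) (hmean i) ht htB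
      _ = Real.exp (t ^ 2 * ∑ i, ∫ ω, X i ω ^ 2 ∂P) := by
          rw [← Real.exp_sum, Finset.mul_sum]
      _ ≤ _ := Real.exp_le_exp.2 (mul_le_mul_of_nonneg_left hvar (sq_nonneg t))
  rw [Real.exp_add, neg_mul]
  exact mul_le_mul_of_nonneg_left hmgf (Real.exp_pos _).le

theorem measureReal_abs_sum_ge_le_exp {X : ι → Ω → ℝ} (hindep : iIndepFun X P)
    (hm : ∀ i, Measurable (X i)) {B S t : ℝ} (hbd : ∀ i ω, |X i ω| ≤ B)
    (hmean : ∀ i, ∫ ω, X i ω ∂P = 0) (hvar : ∑ i, ∫ ω, X i ω ^ 2 ∂P ≤ S) (ht : 0 ≤ t)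
    (htB : t * B ≤ 1) (κ : ℝ) :
    P.real {ω | κ ≤ |∑ i, X i ω|} ≤ 2 * Real.exp (-(t * κ) + t ^ 2 * S) := by
  have h1 := measureReal_sum_ge_le_exp hindep hm hbd hmean hvar ht htB κ
  have h2 := measureReal_sum_ge_le_exp (X := fun i ω => -X i ω)
    (hindep.comp (fun _ x => -x) fun _ => measurable_neg) (fun i => (hm i).neg)
    (B := B) (S := S) (t := t) (by simpa using hbd)
    (fun i => by rw [integral_neg, hmean, neg_zero]) (by simpa using hvar) ht htB κ
  have hsub : {ω | κ ≤ |∑ i, X i ω|} ⊆ {ω | κ ≤ ∑ i, X i ω} ∪ {ω | κ ≤ ∑ i, -X i ω} := by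
    intro ω hω
    rcases le_abs.1 (show κ ≤ |∑ i, X i ω| from hω) with h | h
    · exact Or.inl h
    · exact Or.inr (by simpa using h)
  calc _ ≤ _ := measureReal_mono hsub
    _ ≤ _ := measureReal_union_le _ _
    _ ≤ _ := by linarith

/-- The derivative of the rescaled kernel `g⁻¹ L(· / g)`. -/
noncomputable def kernelSlope (L : ℝ → ℝ) (g t : ℝ) : ℝ := 1 / g ^ 2 * deriv L (t / g)

/-- The expected slope `E (g⁻¹ L(· / g))' (z - ε)` when `ε` has law `ν`. -/
noncomputable def meanSlope (L : ℝ → ℝ) (ν : Measure ℝ) (g z : ℝ) : ℝ :=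
  ∫ u, kernelSlope L g (z - u) ∂ν

/-- The centred weighted sum of kernel slopes at `y` for observations `m i + Z i`. -/
noncomputable def slopeDeviation (L : ℝ → ℝ) (ν : Measure ℝ) (g : ℝ) (w m : ι → ℝ)
    (Z : ι → Ω → ℝ) (y : ℝ) (ω : Ω) : ℝ :=
  ∑ i, w i * (kernelSlope L g (y - m i - Z i ω) - meanSlope L ν g (y - m i))

theorem kernelSlope_continuous {L : ℝ → ℝ} (hL : Continuous (deriv L)) (g : ℝ) :
    Continuous (kernelSlope L g) := by
  unfold kernelSlope; fun_prop

theorem abs_kernelSlope_le {L : ℝ → ℝ} {M : ℝ} (hM : ∀ v, |deriv L v| ≤ M) (g t : ℝ) :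
    |kernelSlope L g t| ≤ M / g ^ 2 := by
  rw [kernelSlope, abs_mul, abs_of_nonneg (by positivity), div_eq_mul_one_div M, mul_comm M]
  exact mul_le_mul_of_nonneg_left (hM _) (by positivity)

theorem abs_kernelSlope_sub_le {L : ℝ → ℝ} {C : NNReal} (hC : LipschitzWith C (deriv L)) {g : ℝ}
    (hg : 0 < g) (t t' : ℝ) :
    |kernelSlope L g t - kernelSlope L g t'| ≤ C / g ^ 3 * |t - t'| := by
  have h1 := hC.dist_le_mul (t / g) (t' / g)
  rw [Real.dist_eq, Real.dist_eq, ← sub_div, abs_div, abs_of_pos hg] at h1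
  rw [kernelSlope, kernelSlope, ← mul_sub, abs_mul, abs_of_nonneg (by positivity)]
  calc _ ≤ 1 / g ^ 2 * (C * (|t - t'| / g)) := mul_le_mul_of_nonneg_left h1 (by positivity)
    _ = _ := by field_simp

section Law

variable {ν : Measure ℝ} [IsProbabilityMeasure ν]

theorem integrable_kernelSlope {L : ℝ → ℝ} (hL : Continuous (deriv L)) {M : ℝ}
    (hM : ∀ v, |deriv L v| ≤ M) (g z : ℝ) : Integrable (fun u => kernelSlope L g (z - u)) ν :=
  Integrable.of_bound
    ((kernelSlope_continuous hL g).comp (by fun_prop)).aestronglyMeasurable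
    (M / g ^ 2) (Eventually.of_forall fun u => abs_kernelSlope_le hM g _)

theorem abs_meanSlope_le {L : ℝ → ℝ} {M : ℝ} (hM : ∀ v, |deriv L v| ≤ M) (g z : ℝ) :
    |meanSlope L ν g z| ≤ M / g ^ 2 := by
  have := norm_integral_le_of_norm_le_const (μ := ν) (f := fun u => kernelSlope L g (z - u))
    (Eventually.of_forall fun u => abs_kernelSlope_le hM g (z - u))
  simpa [meanSlope] using this

theorem abs_meanSlope_sub_le {L : ℝ → ℝ} {C : NNReal} (hC : LipschitzWith C (deriv L)) {M : ℝ}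
    (hM : ∀ v, |deriv L v| ≤ M) {g : ℝ} (hg : 0 < g) (z z' : ℝ) :
    |meanSlope L ν g z - meanSlope L ν g z'| ≤ C / g ^ 3 * |z - z'| := by
  rw [meanSlope, meanSlope, ← integral_sub (integrable_kernelSlope hC.continuous hM g z)
    (integrable_kernelSlope hC.continuous hM g z')]
  have := norm_integral_le_of_norm_le_const (μ := ν) (C := C / g ^ 3 * |z - z'|)
    (f := fun u => kernelSlope L g (z - u) - kernelSlope L g (z' - u))
    (Eventually.of_forall fun u => by
      have := abs_kernelSlope_sub_le hC hg (z - u) (z' - u)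
      rwa [sub_sub_sub_cancel_right] at this)
  simpa using this

theorem abs_slopeDeviation_sub_le {Ω : Type*} {L : ℝ → ℝ} {C : NNReal}
    (hC : LipschitzWith C (deriv L))
    {M : ℝ} (hM : ∀ v, |deriv L v| ≤ M) {g : ℝ} (hg : 0 < g) {w m : ι → ℝ} (hw : ∀ i, 0 ≤ w i)
    (hw2 : ∑ i, w i ≤ 2) (Z : ι → Ω → ℝ) (y y' : ℝ) (ω : Ω) :
    |slopeDeviation L ν g w m Z y ω - slopeDeviation L ν g w m Z y' ω| ≤
      4 * C / g ^ 3 * |y - y'| := by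
  rw [slopeDeviation, slopeDeviation, ← Finset.sum_sub_distrib]
  calc _ ≤ ∑ i, w i * (2 * (C / g ^ 3 * |y - y'|)) := by
        refine (Finset.abs_sum_le_sum_abs _ _).trans (Finset.sum_le_sum fun i _ => ?_)
        rw [← mul_sub, abs_mul, abs_of_nonneg (hw i)]
        refine mul_le_mul_of_nonneg_left ?_ (hw i)
        have h1 := abs_kernelSlope_sub_le hC hg (y - m i - Z i ω) (y' - m i - Z i ω)
        have h2 := abs_meanSlope_sub_le (ν := ν) hC hM hg (y - m i) (y' - m i)
        rw [sub_sub_sub_cancel_right, sub_sub_sub_cancel_right] at h1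
        rw [sub_sub_sub_cancel_right] at h2
        rw [sub_sub_sub_comm]
        refine (abs_sub _ _).trans ?_
        linarith
    _ = (∑ i, w i) * (2 * (C / g ^ 3 * |y - y'|)) := by rw [Finset.sum_mul]
    _ ≤ 2 * (2 * (C / g ^ 3 * |y - y'|)) := by gcongr
    _ = _ := by ring

theorem measureReal_slopeDeviation_ge_le {L : ℝ → ℝ} (hL : Continuous (deriv L)) {M : ℝ}
    (hM : ∀ v, |deriv L v| ≤ M) {g V b t : ℝ} (hg : 0 < g)
    (hV : ∀ z, ∫ u, deriv L ((z - u) / g) ^ 2 ∂ν ≤ V * g) {w m : ι → ℝ} (hw : ∀ i, 0 ≤ w i)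
    (hwb : ∀ i, w i ≤ b) (hw2 : ∑ i, w i ≤ 2) (hb : 0 ≤ b) (hV0 : 0 ≤ V) {Z : ι → Ω → ℝ}
    (hZm : ∀ i, Measurable (Z i)) (hZ : ∀ i, P.map (Z i) = ν) (hind : iIndepFun Z P)
    (ht : 0 ≤ t) (htb : t * (b * (2 * M / g ^ 2)) ≤ 1) (y κ : ℝ) :
    P.real {ω | κ ≤ |slopeDeviation L ν g w m Z y ω|} ≤
      2 * Real.exp (-(t * κ) + t ^ 2 * (2 * b * V / g ^ 3)) := by
  set F : ι → ℝ → ℝ := fun i u =>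
    w i * (kernelSlope L g (y - m i - u) - meanSlope L ν g (y - m i)) with hF
  have hkc := kernelSlope_continuous hL g
  have hFm : ∀ i, Measurable (F i) := fun i => by
    have : Continuous (F i) := by fun_prop
    exact this.measurable
  have hM0 : 0 ≤ M := (abs_nonneg _).trans (hM 0)
  have hpush : ∀ (i : ι) (G : ℝ → ℝ), Measurable G → ∫ ω, G (Z i ω) ∂P = ∫ u, G u ∂ν := by
    intro i G hG
    rw [← hZ i, integral_map (hZm i).aemeasurable hG.aestronglyMeasurable]
  have hki := fun i => integrable_kernelSlope (ν := ν) hL hM g (y - m i)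
  have hk2 : ∀ i, Integrable (fun u => kernelSlope L g (y - m i - u) ^ 2) ν := fun i =>
    Integrable.of_bound
      (((hkc.comp (by fun_prop : Continuous fun u => y - m i - u)).pow 2).aestronglyMeasurable)
      ((M / g ^ 2) ^ 2) (Eventually.of_forall fun u => by
        rw [Real.norm_eq_abs, abs_pow]
        exact pow_le_pow_left₀ (abs_nonneg _) (abs_kernelSlope_le hM g _) 2)
  refine measureReal_abs_sum_ge_le_exp (X := fun i ω => F i (Z i ω)) (hind.comp F hFm)
    (fun i => (hFm i).comp (hZm i)) (B := b * (2 * M / g ^ 2)) ?_ ?_ ?_ ht htb κ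
  · intro i ω
    simp only [hF]
    rw [abs_mul, abs_of_nonneg (hw i)]
    refine mul_le_mul (hwb i) ?_ (abs_nonneg _) hb
    refine (abs_sub _ _).trans ?_
    have h1 := abs_kernelSlope_le hM g (y - m i - Z i ω)
    have h2 := abs_meanSlope_le (ν := ν) hM g (y - m i)
    calc _ ≤ M / g ^ 2 + M / g ^ 2 := add_le_add h1 h2
      _ = _ := by ring
  · intro i
    rw [hpush i (F i) (hFm i)]
    simp only [hF]
    rw [integral_const_mul, integral_sub (hki i) (integrable_const _)]
    simp [meanSlope]
  · have hone : ∀ i, ∫ ω, F i (Z i ω) ^ 2 ∂P ≤ w i * (b * (V / g ^ 3)) := by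
      intro i
      rw [hpush i (fun u => F i u ^ 2) ((hFm i).pow_const 2)]
      have e : ∀ u, F i u ^ 2 = w i ^ 2 * (kernelSlope L g (y - m i - u) ^ 2 -
          2 * meanSlope L ν g (y - m i) * kernelSlope L g (y - m i - u) +
          meanSlope L ν g (y - m i) ^ 2) := fun u => by simp only [hF]; ring
      have hi1 : Integrable (fun u => kernelSlope L g (y - m i - u) ^ 2 -
          2 * meanSlope L ν g (y - m i) * kernelSlope L g (y - m i - u)) ν :=
        (hk2 i).sub ((hki i).const_mul _)
      have h1 : ∫ u, F i u ^ 2 ∂ν = w i ^ 2 * ((∫ u, kernelSlope L g (y - m i - u) ^ 2 ∂ν) -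
          meanSlope L ν g (y - m i) ^ 2) := by
        simp_rw [e]
        rw [integral_const_mul, integral_add hi1 (integrable_const _),
          integral_sub (hk2 i) ((hki i).const_mul _), integral_const_mul]
        simp only [integral_const, probReal_univ, one_smul]
        rw [show ∫ u, kernelSlope L g (y - m i - u) ∂ν = meanSlope L ν g (y - m i) from rfl]
        ring
      have h2 : ∫ u, kernelSlope L g (y - m i - u) ^ 2 ∂ν ≤ V / g ^ 3 := by
        simp_rw [kernelSlope, mul_pow]
        rw [integral_const_mul]
        calc _ ≤ (1 / g ^ 2) ^ 2 * (V * g) :=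
              mul_le_mul_of_nonneg_left (hV _) (by positivity)
          _ = _ := by field_simp
      rw [h1, sq (w i), mul_assoc]
      refine mul_le_mul_of_nonneg_left ?_ (hw i)
      calc _ ≤ w i * (V / g ^ 3) :=
            mul_le_mul_of_nonneg_left (by linarith [sq_nonneg (meanSlope L ν g (y - m i))]) (hw i)
        _ ≤ _ := mul_le_mul_of_nonneg_right (hwb i) (by positivity)
    calc _ ≤ ∑ i, w i * (b * (V / g ^ 3)) := Finset.sum_le_sum fun i _ => hone i
      _ = (∑ i, w i) * (b * (V / g ^ 3)) := by rw [Finset.sum_mul]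
      _ ≤ 2 * (b * (V / g ^ 3)) := mul_le_mul_of_nonneg_right hw2 (by positivity)
      _ = _ := by ring

/-- Union bound over a grid of mesh proportional to `g ^ 3`, which the Lipschitz constant of the
slope requires. -/
theorem measureReal_exists_slopeDeviation_gt_le {L : ℝ → ℝ} {C : NNReal} (hC0 : 0 < C)
    (hC : LipschitzWith C (deriv L)) {M : ℝ}
    (hM : ∀ v, |deriv L v| ≤ M) {g V b t : ℝ} (hg : 0 < g)
    (hV : ∀ z, ∫ u, deriv L ((z - u) / g) ^ 2 ∂ν ≤ V * g) {w m : ι → ℝ} (hw : ∀ i, 0 ≤ w i)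
    (hwb : ∀ i, w i ≤ b) (hw2 : ∑ i, w i ≤ 2) (hb : 0 ≤ b) (hV0 : 0 ≤ V) {Z : ι → Ω → ℝ}
    (hZm : ∀ i, Measurable (Z i)) (hZ : ∀ i, P.map (Z i) = ν) (hind : iIndepFun Z P)
    (ht : 0 ≤ t) (htb : t * (b * (2 * M / g ^ 2)) ≤ 1) (y₀ : ℝ) {κ R : ℝ} (hκ : 0 < κ)
    (hR : 0 ≤ R) :
    P.real {ω | ∃ y ∈ Icc (y₀ - R) (y₀ + R), 2 * κ < |slopeDeviation L ν g w m Z y ω|} ≤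
      (8 * C * R / κ / g ^ 3 + 1) *
        (2 * Real.exp (-(t * κ) + t ^ 2 * (2 * b * V / g ^ 3))) := by
  have hC0' : (0 : ℝ) < C := by exact_mod_cast hC0
  set ρ : ℝ := κ * g ^ 3 / (4 * C) with hρ
  have hρ0 : 0 < ρ := by positivity
  set N := ⌊2 * R / ρ⌋₊ with hN
  have hsub : {ω | ∃ y ∈ Icc (y₀ - R) (y₀ + R), 2 * κ < |slopeDeviation L ν g w m Z y ω|} ⊆
      ⋃ k ∈ Finset.range (N + 1), {ω | κ ≤ |slopeDeviation L ν g w m Z (y₀ - R + k * ρ) ω|} := by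
    rintro ω ⟨y, hy, hyκ⟩
    have hq : 0 ≤ (y - (y₀ - R)) / ρ := div_nonneg (by linarith [hy.1]) hρ0.le
    simp only [mem_iUnion]
    refine ⟨⌊(y - (y₀ - R)) / ρ⌋₊, ?_, ?_⟩
    · rw [Finset.mem_range, Nat.lt_succ_iff]
      exact Nat.floor_le_floor (div_le_div_of_nonneg_right (by linarith [hy.2]) hρ0.le)
    · set k := ⌊(y - (y₀ - R)) / ρ⌋₊
      have h1 : (k : ℝ) * ρ ≤ y - (y₀ - R) := (le_div_iff₀ hρ0).1 (Nat.floor_le hq)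
      have h2 : y - (y₀ - R) < (k + 1) * ρ := (div_lt_iff₀ hρ0).1 (Nat.lt_floor_add_one _)
      have h3 := abs_slopeDeviation_sub_le (ν := ν) (m := m) hC hM hg hw hw2 Z y (y₀ - R + k * ρ) ω
      have h4 : |y - (y₀ - R + k * ρ)| ≤ ρ := by
        rw [abs_le]; constructor <;> linarith
      have h5 : 4 * C / g ^ 3 * |y - (y₀ - R + k * ρ)| ≤ κ := by
        calc _ ≤ 4 * C / g ^ 3 * ρ := by gcongr
          _ = κ := by rw [hρ]; field_simp
      have h6 := abs_sub_abs_le_abs_sub (slopeDeviation L ν g w m Z y ω)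
        (slopeDeviation L ν g w m Z (y₀ - R + k * ρ) ω)
      show κ ≤ _
      linarith
  calc _ ≤ _ := measureReal_mono hsub (measure_ne_top _ _)
    _ ≤ _ := measureReal_biUnion_finset_le _ _
    _ ≤ ∑ _k ∈ Finset.range (N + 1),
        2 * Real.exp (-(t * κ) + t ^ 2 * (2 * b * V / g ^ 3)) :=
      Finset.sum_le_sum fun k _ => measureReal_slopeDeviation_ge_le hC.continuous hM hg hV hw hwb
        hw2 hb hV0 hZm hZ hind ht htb _ κ
    _ = (N + 1) * (2 * Real.exp (-(t * κ) + t ^ 2 * (2 * b * V / g ^ 3))) := by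
      rw [Finset.sum_const, Finset.card_range, nsmul_eq_mul]; push_cast; ring
    _ ≤ _ := by
      refine mul_le_mul_of_nonneg_right ?_ (by positivity)
      have : (N : ℝ) ≤ 2 * R / ρ := Nat.floor_le (by positivity)
      have e : 2 * R / ρ = 8 * C * R / κ / g ^ 3 := by rw [hρ]; field_simp; ring
      linarith

end Law

end Bernstein

/-! ### Convergence of the slope of the score and consistency -/

/-- The weight with which the pixel `p` enters the score function at `x`. -/
noncomputable def weight (K : Plane → ℝ) (h : ℝ) (n : ℕ) (x : Plane) (p : Fin n × Fin n) : ℝ :=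
  1 / (n : ℝ) ^ 2 * (1 / h ^ 2 * K (h⁻¹ • (x - pixel n p.1 p.2)))

namespace AssumptionB3

variable {K : Plane → ℝ}

theorem nonneg' (hK : AssumptionB3 K) (u : Plane) : 0 ≤ K u := by
  by_cases hu : ∀ k, u k ∈ Ioo (-1 : ℝ) 1
  · exact hK.nonneg u hu
  · exact (hK.eq_zero u hu).ge

theorem eq_zero_of_two_le (hK : AssumptionB3 K) (u : Plane) (hu : 2 ≤ ‖u‖) : K u = 0 := by
  refine hK.eq_zero u fun h => ?_
  have h0 := abs_lt.2 (h 0)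
  have h1 := abs_lt.2 (h 1)
  linarith [norm_le_abs_add_abs u]

theorem exists_bound (hK : AssumptionB3 K) : ∃ B, 0 < B ∧ ∀ u, K u ≤ B := by
  obtain ⟨C, hC⟩ := hK.lipschitz
  refine ⟨K 0 + C * 2, by have := hK.pos; positivity, fun u => ?_⟩
  rcases le_total 2 ‖u‖ with h | h
  · rw [hK.eq_zero_of_two_le u h]; have := hK.pos; positivity
  · have h1 := hC.dist_le_mul u 0
    rw [Real.dist_eq, dist_zero_right] at h1
    have h2 := le_abs_self (K u - K 0)
    have h3 : (C : ℝ) * ‖u‖ ≤ C * 2 := by gcongr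
    linarith

theorem weight_nonneg (hK : AssumptionB3 K) (h : ℝ) (n : ℕ) (x : Plane) (p : Fin n × Fin n) :
    0 ≤ weight K h n x p := by
  have := hK.nonneg' (h⁻¹ • (x - pixel n p.1 p.2))
  unfold weight; positivity

/-- Only pixels within distance `2 h` of `x` carry weight. -/
theorem weight_eq_zero (hK : AssumptionB3 K) {h : ℝ} (hh : 0 < h) {n : ℕ} {x : Plane}
    {p : Fin n × Fin n} (hp : 2 * h ≤ ‖x - pixel n p.1 p.2‖) : weight K h n x p = 0 := by
  rw [weight, hK.eq_zero_of_two_le, mul_zero, mul_zero]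
  rwa [norm_smul, norm_inv, Real.norm_of_nonneg hh.le, inv_mul_eq_div, le_div_iff₀ hh]

theorem tendsto_sum_weight (hK : AssumptionB3 K) {x₀ : Plane} (hx₀ : x₀ ∈ openSquare) {h : ℕ → ℝ}
    (hpos : ∀ n, 0 < h n) (hh : Tendsto h atTop (𝓝 0))
    (hnh : Tendsto (fun n : ℕ => (n : ℝ) * h n) atTop atTop) :
    Tendsto (fun n => ∑ p, weight K (h n) n x₀ p) atTop (𝓝 1) := by
  obtain ⟨C, hC⟩ := hK.lipschitz
  have := tendsto_riemannSum hC hK.eq_zero_of_two_le hx₀ hpos hh hnh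
  rwa [hK.integral] at this

end AssumptionB3

theorem hasDerivAt_score (K : Plane → ℝ) {L : ℝ → ℝ} (hL : Differentiable ℝ L) (h g : ℝ) (n : ℕ)
    (Y : Fin n → Fin n → ℝ) (x : Plane) (y : ℝ) :
    HasDerivAt (score K L h g n Y x)
      (∑ p : Fin n × Fin n, weight K h n x p * kernelSlope L g (y - Y p.1 p.2)) y := by
  have h1 : ∀ i j, HasDerivAt (fun y => (1 / h ^ 2 * K (h⁻¹ • (x - pixel n i j))) *
      (1 / g * L ((y - Y i j) / g)))
      ((1 / h ^ 2 * K (h⁻¹ • (x - pixel n i j))) * kernelSlope L g (y - Y i j)) y := by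
    intro i j
    have h2 : HasDerivAt (fun y : ℝ => (y - Y i j) / g) (1 / g) y :=
      ((hasDerivAt_id y).sub_const _).div_const g
    have h3 := ((hL ((y - Y i j) / g)).hasDerivAt.comp y h2).const_mul (1 / g)
    refine (h3.const_mul _).congr_deriv ?_
    rw [kernelSlope]; ring
  have h4 := (HasDerivAt.fun_sum fun i (_ : i ∈ Finset.univ) =>
    HasDerivAt.fun_sum fun j (_ : j ∈ Finset.univ) => h1 i j).const_mul (1 / (n : ℝ) ^ 2)
  refine h4.congr_deriv ?_
  rw [Fintype.sum_prod_type]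
  simp only [Finset.mul_sum, weight, mul_assoc]

/-- The score kernel and the bandwidths make the expected slope of the score of pure noise of law
`ν` converge uniformly to a Lipschitz function `φ`, which on the open interval `I` carrying `ν`
has the sign pattern of the derivative of a function with a single peak at `0`. The moment and
rate conditions are those under which the exponential inequality beats the union bound. -/
structure IsLimitSlope (ν : Measure ℝ) (L : ℝ → ℝ) (h g : ℕ → ℝ) (φ : ℝ → ℝ) (I : Set ℝ) :
    Prop where
  differentiable : Differentiable ℝ L
  lipschitz_deriv : ∃ C, LipschitzWith C (deriv L)
  bounded_deriv : ∃ M, ∀ v, |deriv L v| ≤ M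
  second_moment : ∃ V, ∀ n z, ∫ u, deriv L ((z - u) / g n) ^ 2 ∂ν ≤ V * g n
  h_pos : ∀ n, 0 < h n
  g_pos : ∀ n, 0 < g n
  h_tendsto : Tendsto h atTop (𝓝 0)
  g_bounded : ∃ B, ∀ n, g n ≤ B
  pixels : Tendsto (fun n : ℕ => (n : ℝ) * h n) atTop atTop
  rate : ∀ c > 0, Tendsto (fun n : ℕ =>
    (g n)⁻¹ ^ 3 * Real.exp (-(c * ((n * h n) ^ 2 * g n ^ 3)))) atTop (𝓝 0)
  limit : ∀ τ > 0, ∀ᶠ n in atTop, ∀ z, |meanSlope L ν (g n) z - φ z| ≤ τ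
  lipschitz : ∃ C, LipschitzWith C φ
  isOpen : IsOpen I
  ordConnected : I.OrdConnected
  zero_mem : (0 : ℝ) ∈ I
  carrier : ν Iᶜ = 0
  pos : ∀ z ∈ I, z < 0 → 0 < φ z
  neg : ∀ z ∈ I, 0 < z → φ z < 0

section Core

variable {Ω : Type*} [MeasurableSpace Ω] {P : Measure Ω} [IsProbabilityMeasure P]
  {ε : (n : ℕ) → Fin n → Fin n → Ω → ℝ} {ν : Measure ℝ} [IsProbabilityMeasure ν]
  {K : Plane → ℝ} {L : ℝ → ℝ} {h g : ℕ → ℝ} {φ : ℝ → ℝ} {I : Set ℝ}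

/-- The slope of the score converges to its mean in probability, uniformly on compact sets. -/
theorem IsLimitSlope.tendsto_measure_slopeDeviation (hS : IsLimitSlope ν L h g φ I)
    (hm : ∀ n i j, Measurable (ε n i j)) (hlaw : ∀ n i j, P.map (ε n i j) = ν)
    (hind : ∀ n, iIndepFun (fun p : Fin n × Fin n => ε n p.1 p.2) P) (hK : AssumptionB3 K)
    {x₀ : Plane} (hx₀ : x₀ ∈ openSquare) (m : Plane → ℝ) (y₀ : ℝ) {κ R : ℝ} (hκ : 0 < κ)
    (hR : 0 ≤ R) :
    Tendsto (fun n => P {ω | ∃ y ∈ Icc (y₀ - R) (y₀ + R), κ < |slopeDeviation L ν (g n)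
      (weight K (h n) n x₀) (fun p => m (pixel n p.1 p.2)) (fun p => ε n p.1 p.2) y ω|})
      atTop (𝓝 0) := by
  obtain ⟨C₀, hC₀⟩ := hS.lipschitz_deriv
  obtain ⟨M₀, hM₀⟩ := hS.bounded_deriv
  obtain ⟨V₀, hV₀⟩ := hS.second_moment
  obtain ⟨G₀, hG₀⟩ := hS.g_bounded
  obtain ⟨B, hB, hKB⟩ := hK.exists_bound
  set C : NNReal := max C₀ 1
  have hC : LipschitzWith C (deriv L) := hC₀.weaken (le_max_left _ _)
  have hC0 : 0 < C := lt_of_lt_of_le one_pos (le_max_right _ _)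
  set M := max M₀ 1
  have hM : ∀ v, |deriv L v| ≤ M := fun v => (hM₀ v).trans (le_max_left _ _)
  have hM0 : 0 < M := lt_of_lt_of_le one_pos (le_max_right _ _)
  set V := max V₀ 1
  have hV : ∀ n z, ∫ u, deriv L ((z - u) / g n) ^ 2 ∂ν ≤ V * g n := fun n z =>
    (hV₀ n z).trans (mul_le_mul_of_nonneg_right (le_max_left _ _) (hS.g_pos n).le)
  have hV0 : 0 < V := lt_of_lt_of_le one_pos (le_max_right _ _)
  have hG0 : 0 < G₀ := (hS.g_pos 0).trans_le (hG₀ 0)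
  set k := κ / 2 with hk
  have hk0 : 0 < k := half_pos hκ
  -- `t = c (n h)² g³` keeps `t` times a summand below one and halves the Chernoff exponent.
  set c := min (1 / (2 * B * M * G₀)) (k / (4 * B * V)) with hc
  have hc0 : 0 < c := by positivity
  have hc1 : c * (2 * B * M * G₀) ≤ 1 := by
    rw [← le_div_iff₀ (by positivity)]; exact min_le_left _ _
  have hc2 : c * (4 * B * V) ≤ k := by
    rw [← le_div_iff₀ (by positivity)]; exact min_le_right _ _
  have hbound : ∀ᶠ n in atTop, P {ω | ∃ y ∈ Icc (y₀ - R) (y₀ + R), κ < |slopeDeviation L ν (g n)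
      (weight K (h n) n x₀) (fun p => m (pixel n p.1 p.2)) (fun p => ε n p.1 p.2) y ω|} ≤
      ENNReal.ofReal ((8 * C * R / k + G₀ ^ 3) * 2 *
        ((g n)⁻¹ ^ 3 * Real.exp (-(c * k / 2 * ((n * h n) ^ 2 * g n ^ 3))))) := by
    filter_upwards [(hK.tendsto_sum_weight hx₀ hS.h_pos hS.h_tendsto hS.pixels).eventually
      (gt_mem_nhds (by norm_num : (1 : ℝ) < 2)), hS.pixels.eventually_gt_atTop 0] with n hn1 hn2
    have hg := hS.g_pos n
    have hgG := hG₀ n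
    set N := (n * h n) ^ 2 with hN
    have hN0 : 0 < N := by positivity
    have hwb : ∀ p, weight K (h n) n x₀ p ≤ B / N := by
      intro p
      rw [weight, hN]
      have := hKB ((h n)⁻¹ • (x₀ - pixel n p.1 p.2))
      calc _ ≤ 1 / (n : ℝ) ^ 2 * (1 / h n ^ 2 * B) := by gcongr
        _ = _ := by rw [mul_pow]; field_simp
    have key := measureReal_exists_slopeDeviation_gt_le (P := P) (ν := ν)
      (w := weight K (h n) n x₀) (m := fun p => m (pixel n p.1 p.2))
      (Z := fun p => ε n p.1 p.2) (t := c * (N * g n ^ 3)) (b := B / N) hC0 hC hM hg (hV n)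
      (hK.weight_nonneg _ _ _) hwb hn1.le (by positivity) hV0.le (fun p => hm n p.1 p.2)
      (fun p => hlaw n p.1 p.2) (hind n) (by positivity)
      (by
        calc c * (N * g n ^ 3) * (B / N * (2 * M / g n ^ 2)) = c * (2 * B * M * g n) := by
              field_simp
          _ ≤ c * (2 * B * M * G₀) := by gcongr
          _ ≤ 1 := hc1) y₀ hk0 hR
    rw [← ofReal_measureReal]
    refine ENNReal.ofReal_le_ofReal ?_
    rw [show 2 * k = κ by rw [hk]; ring] at key
    refine key.trans ?_
    have hexp : -(c * (N * g n ^ 3) * k) + (c * (N * g n ^ 3)) ^ 2 * (2 * (B / N) * V / g n ^ 3) ≤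
        -(c * k / 2 * (N * g n ^ 3)) := by
      have e : (c * (N * g n ^ 3)) ^ 2 * (2 * (B / N) * V / g n ^ 3) =
          c * (4 * B * V) * (c * (N * g n ^ 3)) / 2 := by field_simp; ring
      rw [e]
      have : c * (4 * B * V) * (c * (N * g n ^ 3)) ≤ k * (c * (N * g n ^ 3)) := by gcongr
      linarith
    have hcount : 8 * C * R / k / g n ^ 3 + 1 ≤ (8 * C * R / k + G₀ ^ 3) * (g n)⁻¹ ^ 3 := by
      have : 1 ≤ G₀ ^ 3 * (g n)⁻¹ ^ 3 := by
        rw [← mul_pow]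
        exact one_le_pow₀ (by rw [← div_eq_mul_inv, one_le_div hg]; exact hgG)
      rw [add_mul, inv_pow, ← div_eq_mul_inv, ← inv_pow]
      linarith
    calc _ ≤ (8 * C * R / k + G₀ ^ 3) * (g n)⁻¹ ^ 3 *
          (2 * Real.exp (-(c * k / 2 * (N * g n ^ 3)))) :=
          mul_le_mul hcount (mul_le_mul_of_nonneg_left (Real.exp_le_exp.2 hexp) zero_le_two)
            (by positivity) (by positivity)
      _ = _ := by ring
  have hlim := (hS.rate (c * k / 2) (by positivity)).const_mul ((8 * C * R / k + G₀ ^ 3) * 2)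
  rw [mul_zero] at hlim
  have hlim' := ENNReal.tendsto_ofReal hlim
  rw [ENNReal.ofReal_zero] at hlim'
  exact tendsto_of_tendsto_of_tendsto_of_le_of_le' tendsto_const_nhds hlim'
    (Eventually.of_forall fun _ => bot_le) hbound

/-- Consistency at `x₀` along a sequence of grids, provided that the data at the central pixel is
eventually centred near `m₀` and that the mean slope of the score near `m₀` is bounded below by a
fixed multiple of the slope of a single peak at `m₀`. -/
theorem IsLimitSlope.tendsto_measure_mSmoother (hS : IsLimitSlope ν L h g φ I) (hν : ν ≪ volume)
    (hm : ∀ n i j, Measurable (ε n i j)) (hlaw : ∀ n i j, P.map (ε n i j) = ν)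
    (hind : ∀ n, iIndepFun (fun p : Fin n × Fin n => ε n p.1 p.2) P) (hK : AssumptionB3 K)
    {x₀ : Plane} (hx₀ : x₀ ∈ openSquare) {m : Plane → ℝ} {m₀ : ℝ} {s : ℕ → ℕ}
    (hs : Tendsto s atTop atTop)
    (hcentre : ∀ δ > 0, ∀ᶠ l in atTop, ∀ i j, IsCentre (s l) x₀ i j →
      |m (pixel (s l) i j) - m₀| ≤ δ)
    {a₀ : ℝ} (ha₀ : 0 < a₀)
    (hmean : ∀ τ > 0, ∀ᶠ l in atTop, ∃ a ≥ a₀, ∀ z ∈ I,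
      |∑ p, weight K (h (s l)) (s l) x₀ p * φ (z + m₀ - m (pixel (s l) p.1 p.2)) - a * φ z| ≤ τ)
    {η : ℝ} (hη : 0 < η) :
    Tendsto (fun l => P {ω | η < |mSmoother K L h g m ε (s l) x₀ ω - m₀|}) atTop (𝓝 0) := by
  rw [ENNReal.tendsto_nhds_zero]
  intro τ hτ
  have hτ2 : τ / 2 ≠ 0 := (ENNReal.half_pos hτ.ne').ne'
  -- A compact set off `0` carrying most of the noise.
  have hopen : IsOpen (I \ {0}) := hS.isOpen.sdiff isClosed_singleton
  have hfull : ν (I \ {0})ᶜ = 0 := by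
    have : (I \ {0})ᶜ = Iᶜ ∪ {0} := by ext; simp [imp_iff_not_or, or_comm]
    rw [this]
    exact measure_union_null hS.carrier (hν Real.volume_singleton)
  obtain ⟨S, hSsub, hScomp, hSν⟩ :=
    hopen.measurableSet.exists_isCompact_lt_add (measure_ne_top ν _) hτ2
  have hSc : ν Sᶜ ≤ τ / 2 := by
    have h1 : ν Sᶜ ≤ ν ((I \ {0}) \ S) := by
      calc ν Sᶜ ≤ ν (((I \ {0}) \ S) ∪ (I \ {0})ᶜ) := by
            refine measure_mono fun z hz => ?_
            by_cases h : z ∈ I \ {0}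
            · exact Or.inl ⟨h, hz⟩
            · exact Or.inr h
        _ ≤ _ := measure_union_le _ _
        _ = _ := by rw [hfull, add_zero]
    refine h1.trans ?_
    rw [measure_sdiff hSsub hScomp.measurableSet.nullMeasurableSet (measure_ne_top ν _)]
    exact tsub_le_iff_left.2 hSν.le
  obtain ⟨δ, hδ, hTsub⟩ := hScomp.exists_cthickening_subset_open hopen hSsub
  set T := Metric.cthickening δ S with hT
  have hTcomp : IsCompact T := hScomp.cthickening
  -- A radius below which neither `T` nor the complement of `I` reaches.
  obtain ⟨r₁, hr₁, hball⟩ : ∃ r₁ > 0, Metric.ball (0 : ℝ) r₁ ⊆ I ∩ Tᶜ :=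
    Metric.isOpen_iff.1 (hS.isOpen.inter hTcomp.isClosed.isOpen_compl) 0
      ⟨hS.zero_mem, fun h => (hTsub h).2 rfl⟩
  set r := min η (r₁ / 2) with hr
  have hr0 : 0 < r := lt_min hη (half_pos hr₁)
  have hrr₁ : r < r₁ := (min_le_right _ _).trans_lt (half_lt_self hr₁)
  have hrI : r ∈ I := (hball (by simpa [abs_of_pos hr0] using hrr₁)).1
  have hrI' : -r ∈ I := (hball (by simpa [abs_of_pos hr0] using hrr₁)).1
  have hTr : ∀ z ∈ T, r ≤ |z| := by
    intro z hz
    by_contra hcon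
    exact (hball (by simpa using (not_le.1 hcon).trans hrr₁)).2 hz
  have hU : IsCompact (T ∪ {r, -r}) := hTcomp.union (Set.toFinite _).isCompact
  have hUne : (T ∪ {r, -r}).Nonempty := ⟨r, by simp⟩
  have hUI : T ∪ {r, -r} ⊆ I := by
    rintro z (hz | rfl | rfl)
    · exact (hTsub hz).1
    · exact hrI
    · exact hrI'
  obtain ⟨α, hαU, hα⟩ := hU.exists_isLeast hUne
  obtain ⟨β, hβU, hβ⟩ := hU.exists_isGreatest hUne
  have hαr : α ≤ -r := hα (by simp)
  have hβr : r ≤ β := hβ (by simp)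
  have hI : Icc α β ⊆ I := hS.ordConnected.out (hUI hαU) (hUI hβU)
  obtain ⟨Cφ, hCφ⟩ := hS.lipschitz
  obtain ⟨z₁, hz₁, hmin₁⟩ := isCompact_Icc.exists_isMinOn (nonempty_Icc.2 hαr)
    hCφ.continuous.continuousOn
  obtain ⟨z₂, hz₂, hmax₂⟩ := isCompact_Icc.exists_isMaxOn (nonempty_Icc.2 hβr)
    hCφ.continuous.continuousOn
  have h1pos : 0 < φ z₁ := hS.pos z₁ (hI ⟨hz₁.1, by linarith [hz₁.2]⟩) (by linarith [hz₁.2])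
  have h2neg : φ z₂ < 0 := hS.neg z₂ (hI ⟨by linarith [hz₂.1], hz₂.2⟩) (by linarith [hz₂.1])
  set κ := min (φ z₁) (-φ z₂) with hκ
  have hκ0 : 0 < κ := lt_min h1pos (by linarith)
  have hφl : ∀ z ∈ Icc α (-r), κ ≤ φ z := fun z hz => (min_le_left _ _).trans (hmin₁ hz)
  have hφr : ∀ z ∈ Icc r β, φ z ≤ -κ := fun z hz => by
    have h1 : φ z ≤ φ z₂ := hmax₂ hz
    have h2 : κ ≤ -φ z₂ := min_le_right _ _
    linarith
  set R := max |α| |β| with hR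
  have hR0 : 0 ≤ R := (abs_nonneg α).trans (le_max_left _ _)
  have hdev := (hS.tendsto_measure_slopeDeviation hm hlaw hind hK hx₀ m m₀
    (κ := a₀ * κ / 4) (by positivity) hR0).comp hs
  filter_upwards [(ENNReal.tendsto_nhds_zero.1 hdev) (τ / 2) (ENNReal.half_pos hτ.ne'),
    hs.eventually (hS.limit (a₀ * κ / 8) (by positivity)), hcentre δ hδ,
    hmean (a₀ * κ / 4) (by positivity), hs.eventually (eventually_gt_atTop 0),
    hs.eventually ((hK.tendsto_sum_weight hx₀ hS.h_pos hS.h_tendsto hS.pixels).eventually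
      (gt_mem_nhds (by norm_num : (1 : ℝ) < 2)))] with l hl1 hl2 hl3 hl4 hl5 hl6
  obtain ⟨i₀, j₀, hc⟩ := exists_isCentre hl5 x₀
  obtain ⟨a, ha, hl4⟩ := hl4
  have hcover : {ω | η < |mSmoother K L h g m ε (s l) x₀ ω - m₀|} ⊆
      {ω | ∃ y ∈ Icc (m₀ - R) (m₀ + R), a₀ * κ / 4 < |slopeDeviation L ν (g (s l))
      (weight K (h (s l)) (s l) x₀) (fun p => m (pixel (s l) p.1 p.2))
      (fun p => ε (s l) p.1 p.2) y ω|} ∪ ε (s l) i₀ j₀ ⁻¹' Sᶜ := by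
    intro ω hω
    by_contra hcon
    simp only [mem_union, mem_ofPred_eq, mem_preimage, mem_compl_iff, not_or, not_exists, not_and,
      not_lt, not_not] at hcon
    obtain ⟨hsmall, hεS⟩ := hcon
    set Y : Fin (s l) → Fin (s l) → ℝ := fun i j => m (pixel (s l) i j) + ε (s l) i j ω with hY
    have hderiv : ∀ y, deriv (score K L (h (s l)) (g (s l)) (s l) Y x₀) y =
        slopeDeviation L ν (g (s l)) (weight K (h (s l)) (s l) x₀)
          (fun p => m (pixel (s l) p.1 p.2)) (fun p => ε (s l) p.1 p.2) y ω +
        ∑ p, weight K (h (s l)) (s l) x₀ p *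
          meanSlope L ν (g (s l)) (y - m (pixel (s l) p.1 p.2)) := by
      intro y
      rw [(hasDerivAt_score K hS.differentiable _ _ _ _ _ _).deriv, slopeDeviation,
        ← Finset.sum_add_distrib]
      refine Finset.sum_congr rfl fun p _ => ?_
      rw [hY, ← sub_sub]
      ring
    have hclose : ∀ z ∈ Icc α β, |deriv (score K L (h (s l)) (g (s l)) (s l) Y x₀) (z + m₀) -
        a * φ z| ≤ 3 * (a₀ * κ) / 4 := by
      intro z hz
      have hzR : |z| ≤ R := abs_le_max_abs_abs hz.1 hz.2
      have e1 := hsmall (z + m₀) ⟨by linarith [(abs_le.1 hzR).1], by linarith [(abs_le.1 hzR).2]⟩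
      have e2 := hl4 z (hI hz)
      have e3 : |∑ p, weight K (h (s l)) (s l) x₀ p *
          meanSlope L ν (g (s l)) (z + m₀ - m (pixel (s l) p.1 p.2)) -
          ∑ p, weight K (h (s l)) (s l) x₀ p * φ (z + m₀ - m (pixel (s l) p.1 p.2))| ≤
          a₀ * κ / 4 := by
        rw [← Finset.sum_sub_distrib]
        calc _ ≤ ∑ p, weight K (h (s l)) (s l) x₀ p * (a₀ * κ / 8) := by
              refine (Finset.abs_sum_le_sum_abs _ _).trans (Finset.sum_le_sum fun p _ => ?_)
              rw [← mul_sub, abs_mul, abs_of_nonneg (hK.weight_nonneg _ _ _ _)]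
              exact mul_le_mul_of_nonneg_left (hl2 _) (hK.weight_nonneg _ _ _ _)
          _ = (∑ p, weight K (h (s l)) (s l) x₀ p) * (a₀ * κ / 8) := by rw [Finset.sum_mul]
          _ ≤ 2 * (a₀ * κ / 8) := by gcongr
          _ = _ := by ring
      rw [hderiv]
      rw [abs_le] at e1 e2 e3 ⊢
      constructor <;> linarith [e1.1, e1.2, e2.1, e2.2, e3.1, e3.2]
    have haκ : 3 * (a₀ * κ) / 4 < a * κ := by
      have : a₀ * κ ≤ a * κ := by gcongr
      have : 0 < a₀ * κ := by positivity
      linarith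
    have ha0 : 0 < a := ha₀.trans_le ha
    have hpos : ∀ z ∈ Icc α (-r),
        0 < deriv (score K L (h (s l)) (g (s l)) (s l) Y x₀) (z + m₀) := by
      intro z hz
      have e1 := (abs_le.1 (hclose z ⟨hz.1, by linarith [hz.2]⟩)).1
      have e2 : a * κ ≤ a * φ z := by have := hφl z hz; gcongr
      linarith
    have hneg : ∀ z ∈ Icc r β, deriv (score K L (h (s l)) (g (s l)) (s l) Y x₀) (z + m₀) < 0 := by
      intro z hz
      have e1 := (abs_le.1 (hclose z ⟨by linarith [hz.1], hz.2⟩)).2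
      have e2 : a * φ z ≤ a * (-κ) := by have := hφr z hz; gcongr
      linarith
    have hzT : Y i₀ j₀ - m₀ ∈ T := by
      refine Metric.mem_cthickening_of_dist_le _ (ε (s l) i₀ j₀ ω) _ _ hεS ?_
      rw [Real.dist_eq, hY]
      have := hl3 i₀ j₀ hc
      rwa [show m (pixel (s l) i₀ j₀) + ε (s l) i₀ j₀ ω - m₀ - ε (s l) i₀ j₀ ω =
        m (pixel (s l) i₀ j₀) - m₀ by ring]
    have hzα : α ≤ Y i₀ j₀ - m₀ := hα (Or.inl hzT)
    have hzβ : Y i₀ j₀ - m₀ ≤ β := hβ (Or.inl hzT)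
    have hfinal : |mEstimate K L (h (s l)) (g (s l)) (s l) Y x₀ - m₀| ≤ r := by
      refine abs_mEstimate_sub_le hc hr0.le
        (fun y => (hasDerivAt_score K hS.differentiable _ _ _ _ _ y).differentiableAt) ?_ ?_ ?_
      · have := hpos (-r) ⟨hαr, le_rfl⟩
        rwa [neg_add_eq_sub] at this
      · have := hneg r ⟨le_rfl, hβr⟩
        rwa [add_comm] at this
      · rcases le_abs.1 (hTr _ hzT) with h1 | h1
        · refine Or.inl ⟨by linarith, fun y hy => ?_⟩
          have := hneg (y - m₀) ⟨by linarith [hy.1], by linarith [hy.2]⟩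
          rwa [sub_add_cancel] at this
        · refine Or.inr ⟨by linarith, fun y hy => ?_⟩
          have := hpos (y - m₀) ⟨by linarith [hy.1], by linarith [hy.2]⟩
          rwa [sub_add_cancel] at this
    have hω' : η < |mEstimate K L (h (s l)) (g (s l)) (s l) Y x₀ - m₀| := hω
    exact absurd (hfinal.trans (min_le_left _ _)) (not_le.2 hω')
  calc _ ≤ _ := measure_mono hcover
    _ ≤ _ := measure_union_le _ _
    _ ≤ τ / 2 + τ / 2 := by
      refine add_le_add hl1 ?_
      rw [← Measure.map_apply (hm _ _ _) hScomp.measurableSet.compl, hlaw]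
      exact hSc
    _ = τ := ENNReal.add_halves τ

end Core

/-! ### Cones inside a region bounded by edge curves -/

open scoped RealInnerProductSpace

/-- Near each of its parameters an edge curve moves with positive speed in the direction `v` of
the sum of its two one-sided velocities; that sum is nonzero because the angle is not `0`. -/
theorem IsEdgeCurve.exists_direction {c : ℝ → Plane} {ℓ t₀ : ℝ} (hc : IsEdgeCurve c ℓ)
    (ht₀ : t₀ ∈ Ico 0 ℓ) :
    ∃ v : Plane, ‖v‖ = 1 ∧ ∃ σ > 0, ∃ δ > 0, ∀ t, t ≠ t₀ → |t - t₀| < δ →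
      DifferentiableAt ℝ c t ∧ ‖deriv c t‖ ≤ 2 ∧ σ ≤ ⟪v, deriv c t⟫ := by
  obtain ⟨bl, br, hbl, hbr, hne, hl, hr, hd⟩ : ∃ bl br : Plane, ‖bl‖ = 1 ∧ ‖br‖ = 1 ∧ -bl ≠ br ∧
      Tendsto (deriv c) (𝓝[<] t₀) (𝓝 bl) ∧ Tendsto (deriv c) (𝓝[>] t₀) (𝓝 br) ∧
      ∀ᶠ t in 𝓝[≠] t₀, DifferentiableAt ℝ c t ∧ ‖deriv c t‖ ≤ 2 := by
    obtain ⟨T, M, -, -, hreg, hcor⟩ := hc.smooth_off_corners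
    by_cases hT : t₀ ∈ T
    · obtain ⟨α, hα, ⟨δ, hδ, M', hnat⟩, bl, br, hl, hr, hang⟩ := hcor t₀ hT
      have hev : ∀ᶠ t in 𝓝[≠] t₀, NaturalAt c M' t := by
        filter_upwards [self_mem_nhdsWithin,
          mem_nhdsWithin_of_mem_nhds (Metric.ball_mem_nhds t₀ hδ)]
          with t h1 h2
        exact hnat t h1 (by simpa [Real.dist_eq] using h2)
      have hnorm : ∀ {b : Plane} {l : Filter ℝ} [l.NeBot], l ≤ 𝓝[≠] t₀ →
          Tendsto (deriv c) l (𝓝 b) → ‖b‖ = 1 := by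
        intro b l _ hle hb
        refine tendsto_nhds_unique hb.norm ((tendsto_congr' ?_).2 tendsto_const_nhds)
        filter_upwards [hle hev] with t ht using ht.2.1
      have hbl := hnorm (l := 𝓝[<] t₀) (nhdsWithin_mono _ fun x hx => ne_of_lt hx) hl
      have hbr := hnorm (l := 𝓝[>] t₀) (nhdsWithin_mono _ fun x hx => ne_of_gt hx) hr
      refine ⟨bl, br, hbl, hbr, ?_, hl, hr, hev.mono fun t ht => ⟨ht.1, by rw [ht.2.1]; norm_num⟩⟩
      rintro rfl
      rw [InnerProductGeometry.angle_self (by rw [← norm_ne_zero_iff, hbr]; norm_num)] at hang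
      have := Real.pi_pos
      rcases hα with ⟨h1, h2⟩ | ⟨h1, h2⟩ <;> rcases hang with h | h <;> linarith
    · obtain ⟨-, h1, h2, -⟩ := hreg t₀ ⟨ht₀, hT⟩
      have hcont := h2.continuousAt
      refine ⟨deriv c t₀, deriv c t₀, h1, h1, ?_, hcont.mono_left nhdsWithin_le_nhds,
        hcont.mono_left nhdsWithin_le_nhds, mem_nhdsWithin_of_mem_nhds ?_⟩
      · intro h
        have h3 : deriv c t₀ = 0 := by
          have h4 : (2 : ℝ) • deriv c t₀ = 0 := by
            rw [two_smul]; exact add_eq_zero_iff_eq_neg.2 h.symm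
          exact (smul_eq_zero.1 h4).resolve_left two_ne_zero
        rw [h3, norm_zero] at h1
        norm_num at h1
      · have hn := hcont.norm
        rw [ContinuousAt, h1] at hn
        filter_upwards [hn.eventually (lt_mem_nhds (by norm_num : (0 : ℝ) < 1)),
          hn.eventually (gt_mem_nhds (by norm_num : (1 : ℝ) < 2))] with t ht1 ht2
        -- A nonzero value of `deriv` is a genuine derivative.
        refine ⟨?_, ht2.le⟩
        by_contra hcon
        rw [deriv_zero_of_not_differentiableAt hcon, norm_zero] at ht1
        exact lt_irrefl _ ht1
  have hsum : br + bl ≠ 0 := fun h => hne (by rw [eq_comm, ← sub_eq_zero, sub_neg_eq_add]; exact h)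
  have hsum0 : 0 < ‖br + bl‖ := norm_pos_iff.2 hsum
  set v : Plane := ‖br + bl‖⁻¹ • (br + bl) with hv
  have hin : ⟪br + bl, bl⟫ = ⟪br + bl, br⟫ := by
    rw [inner_add_left, inner_add_left, real_inner_self_eq_norm_sq, real_inner_self_eq_norm_sq,
      hbl, hbr, real_inner_comm]; ring
  have hin2 : ⟪br + bl, br⟫ = ‖br + bl‖ ^ 2 / 2 := by
    rw [← real_inner_self_eq_norm_sq (br + bl), inner_add_right, hin]; ring
  set σ := ‖br + bl‖ / 2 with hσ
  have hvr : ⟪v, br⟫ = σ := by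
    rw [hv, real_inner_smul_left, hin2, hσ]; field_simp
  have hvl : ⟪v, bl⟫ = σ := by
    rw [hv, real_inner_smul_left, hin, hin2, hσ]; field_simp
  have hσ0 : 0 < σ := half_pos hsum0
  have key : ∀ᶠ t in 𝓝[≠] t₀, σ / 2 ≤ ⟪v, deriv c t⟫ := by
    have hgen : ∀ {b : Plane} {l : Filter ℝ}, Tendsto (deriv c) l (𝓝 b) → ⟪v, b⟫ = σ →
        ∀ᶠ t in l, σ / 2 ≤ ⟪v, deriv c t⟫ := by
      intro b l hb hvb
      have := (tendsto_const_nhds (x := v)).inner (𝕜 := ℝ) hb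
      rw [hvb] at this
      filter_upwards [this.eventually (lt_mem_nhds (half_lt_self hσ0))] with t ht using ht.le
    rw [← Iio_union_Ioi, nhdsWithin_union]
    exact eventually_sup.2 ⟨hgen hl hvl, hgen hr hvr⟩
  obtain ⟨δ, hδ, hball⟩ := Metric.mem_nhdsWithin_iff.1 (hd.and key)
  refine ⟨v, ?_, σ / 2, half_pos hσ0, δ, hδ, fun t h1 h2 => ?_⟩
  · rw [hv, norm_smul, norm_inv, norm_norm, inv_mul_cancel₀ hsum0.ne']
  · have := hball ⟨by rw [Metric.mem_ball, Real.dist_eq]; exact h2, h1⟩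
    exact ⟨this.1.1, this.1.2, this.2⟩

theorem monotoneOn_of_deriv_nonneg_off_point {f : ℝ → ℝ} {t₀ δ : ℝ} (hf : Continuous f)
    (hd : ∀ t, t ≠ t₀ → |t - t₀| < δ → 0 ≤ deriv f t)
    (hd' : ∀ t, t ≠ t₀ → |t - t₀| < δ → DifferentiableAt ℝ f t) :
    MonotoneOn f (Ioo (t₀ - δ) (t₀ + δ)) := by
  rcases le_or_gt δ 0 with h0 | h0
  · rw [Ioo_eq_empty (by linarith)]; exact Set.subsingleton_empty.monotoneOn f
  have hl : MonotoneOn f (Ioc (t₀ - δ) t₀) := by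
    refine monotoneOn_of_deriv_nonneg (convex_Ioc _ _) hf.continuousOn ?_ ?_ <;>
      rw [interior_Ioc]
    · intro t ht
      exact (hd' t ht.2.ne
        (by rw [abs_lt]; constructor <;> linarith [ht.1, ht.2])).differentiableWithinAt
    · intro t ht
      exact hd t ht.2.ne (by rw [abs_lt]; constructor <;> linarith [ht.1, ht.2])
  have hr : MonotoneOn f (Ico t₀ (t₀ + δ)) := by
    refine monotoneOn_of_deriv_nonneg (convex_Ico _ _) hf.continuousOn ?_ ?_ <;>
      rw [interior_Ico]
    · intro t ht
      exact (hd' t ht.1.ne'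
        (by rw [abs_lt]; constructor <;> linarith [ht.1, ht.2])).differentiableWithinAt
    · intro t ht
      exact hd t ht.1.ne' (by rw [abs_lt]; constructor <;> linarith [ht.1, ht.2])
  have := hl.union_right hr ⟨⟨by linarith, le_rfl⟩, fun x hx => hx.2⟩
    ⟨⟨le_rfl, by linarith⟩, fun x hx => hx.1⟩
  rwa [Ioc_union_Ico_eq_Ioo (by linarith) (by linarith)] at this

theorem exists_unit_orthogonal (v : Plane) (hv : ‖v‖ = 1) : ∃ e : Plane, ‖e‖ = 1 ∧ ⟪v, e⟫ = 0 := by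
  refine ⟨!₂[-v 1, v 0], ?_, ?_⟩
  · have h1 : ‖v‖ ^ 2 = 1 := by rw [hv]; norm_num
    rw [EuclideanSpace.norm_sq_eq] at h1
    simp only [Fin.sum_univ_two, Real.norm_eq_abs, sq_abs] at h1
    rw [← sq_eq_sq₀ (norm_nonneg _) zero_le_one, EuclideanSpace.norm_sq_eq]
    simp only [Fin.sum_univ_two, Real.norm_eq_abs, sq_abs]
    simp
    linarith
  · simp [PiLp.inner_apply, Fin.sum_univ_two]
    ring

theorem IsPreconnected.subset_interior_of_disjoint_frontier {X : Type*} [TopologicalSpace X]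
    {A D : Set X} (hA : IsPreconnected A) (hd : Disjoint A (frontier D))
    (hne : (A ∩ interior D).Nonempty) : A ⊆ interior D := by
  refine hA.subset_left_of_subset_union isOpen_interior
    (isClosed_closure (s := D)).isOpen_compl ?_ ?_ hne
  · exact Set.disjoint_left.2 fun x h1 h2 => h2 (interior_subset_closure h1)
  · intro x hx
    by_contra hcon
    rw [mem_union, not_or, mem_compl_iff, not_not] at hcon
    exact Set.disjoint_left.1 hd hx ⟨hcon.2, hcon.1⟩

theorem IsEdgeCurve.isCompact_range {c : ℝ → Plane} {ℓ : ℝ} (hc : IsEdgeCurve c ℓ) :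
    IsCompact (range c) := by
  have : range c = c '' Icc 0 ℓ := by
    refine Subset.antisymm ?_ (image_subset_range _ _)
    rintro _ ⟨t, rfl⟩
    obtain ⟨t', ht', h⟩ := hc.periodic.exists_mem_Ico₀ hc.length_pos t
    exact ⟨t', Ico_subset_Icc_self ht', h.symm⟩
  rw [this]
  exact isCompact_Icc.image hc.continuous

/-- Close to a point of the boundary, the boundary is a single short arc of an edge curve. -/
theorem AssumptionB2.exists_local_arc {μ : Plane → ℝ} {d : ℝ} {D : Set Plane}
    (hB : AssumptionB2 μ d D) {x₀ : Plane} (hx₀ : x₀ ∈ frontier D) :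
    ∃ (c : ℝ → Plane) (ℓ t₀ : ℝ), IsEdgeCurve c ℓ ∧ range c ⊆ frontier D ∧ t₀ ∈ Ico 0 ℓ ∧
      c t₀ = x₀ ∧ ∀ δ > 0, ∃ R > 0, frontier D ∩ Metric.ball x₀ R ⊆ c '' Ioo (t₀ - δ) (t₀ + δ) := by
  obtain ⟨N, c, ℓ, hc, hdisj, hfr⟩ := hB.boundary
  rw [hfr, mem_iUnion] at hx₀
  obtain ⟨k, s, hs⟩ := hx₀
  obtain ⟨t₀, ht₀, hst⟩ := (hc k).periodic.exists_mem_Ico₀ (hc k).length_pos s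
  have hct₀ : c k t₀ = x₀ := hst ▸ hs
  refine ⟨c k, ℓ k, t₀, hc k, hfr ▸ subset_iUnion (fun k => range (c k)) k, ht₀, hct₀,
    fun δ hδ => ?_⟩
  have hℓ := (hc k).length_pos
  set F : Set Plane :=
    (⋃ j ∈ {j | j ≠ k}, range (c j)) ∪ c k '' Icc (t₀ + δ / 2) (t₀ + ℓ k - δ / 2) with hF
  have hFc : IsClosed F := by
    refine IsClosed.union ?_ (isCompact_Icc.image (hc k).continuous).isClosed
    exact (Set.toFinite _).isClosed_biUnion fun j _ => (hc j).isCompact_range.isClosed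
  have hxF : x₀ ∈ Fᶜ := by
    rintro (h | ⟨t, ht, h⟩)
    · simp only [mem_iUnion] at h
      obtain ⟨j, hj, h⟩ := h
      exact Set.disjoint_left.1 (hdisj hj) h ⟨t₀, hct₀⟩
    · have e : ∃ t' ∈ Ico 0 (ℓ k), c k t' = c k t ∧ t' ≠ t₀ := by
        rcases lt_or_ge t (ℓ k) with hlt | hge
        · exact ⟨t, ⟨by linarith [ht.1, ht₀.1], hlt⟩, rfl,
            ne_of_gt (by linarith [ht.1])⟩
        · refine ⟨t - ℓ k, ⟨by linarith, by linarith [ht.2, ht₀.2]⟩, (hc k).periodic.sub_eq t, ?_⟩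
          exact ne_of_lt (by linarith [ht.2])
      obtain ⟨t', ht', he, hne⟩ := e
      exact hne ((hc k).simple ht' ht₀ (by rw [he, h, hct₀]))
  obtain ⟨R, hR, hball⟩ := Metric.isOpen_iff.1 hFc.isOpen_compl x₀ hxF
  refine ⟨R, hR, ?_⟩
  rintro x ⟨hx, hxR⟩
  rw [hfr, mem_iUnion] at hx
  obtain ⟨j, hj⟩ := hx
  have hxF' := hball hxR
  by_cases hjk : j = k
  · subst hjk
    obtain ⟨t, rfl⟩ := hj
    obtain ⟨t', ht', h⟩ := (hc j).periodic.exists_mem_Ico hℓ t (t₀ - δ / 2)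
    rw [h] at hxF' ⊢
    refine ⟨t', ⟨by linarith [ht'.1], ?_⟩, rfl⟩
    by_contra hcon
    exact hxF' (Or.inr ⟨t', ⟨by linarith, by linarith [ht'.2]⟩, rfl⟩)
  · exact absurd (Or.inl (mem_biUnion (show j ∈ {j | j ≠ k} from hjk) hj)) hxF'

/-- The part near `x₀` of the cone around the direction `e` whose boundary has slope `b` with
respect to the orthogonal direction `v`. -/
def localCone (x₀ v e : Plane) (b R : ℝ) : Set Plane :=
  {x | b * |⟪v, x - x₀⟫| < ⟪e, x - x₀⟫} ∩ Metric.ball x₀ R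

theorem convex_localCone (x₀ v e : Plane) {b : ℝ} (hb : 0 ≤ b) (R : ℝ) :
    Convex ℝ (localCone x₀ v e b R) := by
  refine Convex.inter ?_ (convex_ball _ _)
  have : {x | b * |⟪v, x - x₀⟫| < ⟪e, x - x₀⟫} =
      {x | ⟪b • v - e, x⟫ < ⟪b • v - e, x₀⟫} ∩ {x | ⟪(-b) • v - e, x⟫ < ⟪(-b) • v - e, x₀⟫} := by
    ext x
    simp only [mem_ofPred_eq, mem_inter_iff, inner_sub_left, inner_sub_right, real_inner_smul_left]
    rw [← abs_of_nonneg hb, ← abs_mul, abs_of_nonneg hb, abs_lt]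
    constructor
    · rintro ⟨h1, h2⟩; constructor <;> linarith
    · rintro ⟨h1, h2⟩; constructor <;> linarith
  rw [this]
  exact (convex_halfSpace_lt (innerₛₗ ℝ (b • v - e)).isLinear _).inter
    (convex_halfSpace_lt (innerₛₗ ℝ ((-b) • v - e)).isLinear _)

/-- A region that is the closure of its interior contains a cone at each of its boundary points:
near such a point its boundary is a Lipschitz graph over the direction `v`, and a point of the
interior can be joined, orthogonally to `v` and without meeting the graph, to the cone above or below. -/
theorem AssumptionB2.exists_ball_subset {μ : Plane → ℝ} {d : ℝ} {D : Set Plane}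
    (hB : AssumptionB2 μ d D) (hD : closure (interior D) = D) {x₀ : Plane}
    (hx₀ : x₀ ∈ frontier D) :
    ∃ e : Plane, ‖e‖ = 1 ∧ ∃ κ > 0, κ ≤ 1 ∧ ∃ ρ₀ > 0, ∀ ρ, 0 < ρ → ρ ≤ ρ₀ →
      Metric.ball (x₀ + ρ • e) (κ * ρ) ⊆ D := by
  obtain ⟨c, ℓ, t₀, hc, hcD, ht₀, hct₀, harc⟩ := hB.exists_local_arc hx₀
  obtain ⟨v, hv, σ, hσ, δ, hδ, hloc⟩ := hc.exists_direction ht₀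
  obtain ⟨R, hR, harc⟩ := harc δ hδ
  obtain ⟨e₁, he₁, hve₁⟩ := exists_unit_orthogonal v hv
  set J := Ioo (t₀ - δ) (t₀ + δ)
  have ht₀J : t₀ ∈ J := ⟨by linarith, by linarith⟩
  -- Along the arc the coordinate in the direction `v` grows at rate at least `σ` ...
  have hder : ∀ w : Plane, ∀ a : ℝ, ∀ t, t ≠ t₀ → |t - t₀| < δ →
      HasDerivAt (fun t => ⟪w, c t⟫ + a * t) (⟪w, deriv c t⟫ + a) t := by
    intro w a t h1 h2
    have h3 := (hasDerivAt_const t w).inner ℝ (hloc t h1 h2).1.hasDerivAt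
    simp only [inner_zero_left, add_zero] at h3
    exact (h3.fun_add ((hasDerivAt_id t).const_mul a)).congr_deriv (by simp)
  have hmono : ∀ w : Plane, ∀ a : ℝ, (∀ t, t ≠ t₀ → |t - t₀| < δ → 0 ≤ ⟪w, deriv c t⟫ + a) →
      MonotoneOn (fun t => ⟪w, c t⟫ + a * t) J := by
    intro w a h
    have hcc := hc.continuous
    refine monotoneOn_of_deriv_nonneg_off_point (by fun_prop) (fun t h1 h2 => ?_)
      fun t h1 h2 => (hder w a t h1 h2).differentiableAt
    rw [(hder w a t h1 h2).deriv]
    exact h t h1 h2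
  have hX : ∀ s ∈ J, ∀ t ∈ J, s ≤ t → σ * (t - s) ≤ ⟪v, c t⟫ - ⟪v, c s⟫ := by
    intro s hs t ht hst
    have := hmono v (-σ) (fun t h1 h2 => by linarith [(hloc t h1 h2).2.2]) hs ht hst
    simp only at this
    linarith
  -- ... while every other coordinate changes at rate at most `2`.
  have hZ : ∀ e : Plane, ‖e‖ = 1 → ∀ t ∈ J, ⟪e, c t - x₀⟫ ≤ 2 * |t - t₀| := by
    intro e he t ht
    have hle : ∀ t, t ≠ t₀ → |t - t₀| < δ → |⟪e, deriv c t⟫| ≤ 2 := fun t h1 h2 =>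
      (abs_real_inner_le_norm _ _).trans (by rw [he, one_mul]; exact (hloc t h1 h2).2.1)
    rw [inner_sub_right, ← hct₀]
    rcases le_total t₀ t with h | h
    · have := hmono (-e) 2 (fun t h1 h2 => by
        rw [inner_neg_left]; linarith [(abs_le.1 (hle t h1 h2)).2]) ht₀J ht h
      simp only [inner_neg_left] at this
      rw [abs_of_nonneg (by linarith)]
      linarith
    · have := hmono e 2 (fun t h1 h2 => by linarith [(abs_le.1 (hle t h1 h2)).1]) ht ht₀J h
      simp only at this
      rw [abs_of_nonpos (by linarith)]
      linarith
  set b := 2 / σ with hb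
  have hb0 : 0 < b := by positivity
  have hcone : ∀ e : Plane, ‖e‖ = 1 → Disjoint (localCone x₀ v e b R) (frontier D) := by
    intro e he
    refine Set.disjoint_left.2 fun x hx hxD => ?_
    obtain ⟨t, ht, rfl⟩ := harc ⟨hxD, hx.2⟩
    have h1 : b * |⟪v, c t - x₀⟫| < ⟪e, c t - x₀⟫ := hx.1
    have h2 := hZ e he t ht
    have h3 : σ * |t - t₀| ≤ |⟪v, c t - x₀⟫| := by
      rw [inner_sub_right, ← hct₀]
      rcases le_total t₀ t with h | h
      · rw [abs_of_nonneg (by linarith : 0 ≤ t - t₀)]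
        exact (hX t₀ ht₀J t ht h).trans (le_abs_self _)
      · rw [abs_of_nonpos (by linarith : t - t₀ ≤ 0), abs_sub_comm]
        exact le_trans (by linarith [hX t ht t₀ ht₀J h]) (le_abs_self _)
    have h4 : 2 * |t - t₀| ≤ b * |⟪v, c t - x₀⟫| := by
      calc 2 * |t - t₀| = b * (σ * |t - t₀|) := by rw [hb]; field_simp
        _ ≤ _ := by gcongr
    linarith
  -- A point of the interior near `x₀`; of the two directions orthogonal to `v`, one leads away
  -- from the only point of the arc with the same `v`-coordinate.
  set r := R / (b + 4) with hr
  have hr0 : 0 < r := by positivity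
  obtain ⟨p, hpball, hpD⟩ : (Metric.ball x₀ r ∩ interior D).Nonempty := by
    have : x₀ ∈ closure (interior D) := by rw [hD]; exact hB.isClosed.frontier_subset hx₀
    exact mem_closure_iff.1 this _ Metric.isOpen_ball (Metric.mem_ball_self hr0)
  have hpF : p ∉ frontier D := fun h => h.2 hpD
  rw [mem_ball_iff_norm] at hpball
  obtain ⟨e, he, hve, hup⟩ : ∃ e : Plane, ‖e‖ = 1 ∧ ⟪v, e⟫ = 0 ∧
      ∀ τ : ℝ, 0 ≤ τ → p + τ • e ∉ c '' J := by
    by_contra hcon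
    push Not at hcon
    obtain ⟨τ₁, hτ₁, t₁, ht₁, h1⟩ := hcon e₁ he₁ hve₁
    obtain ⟨τ₂, hτ₂, t₂, ht₂, h2⟩ := hcon (-e₁) (by rw [norm_neg, he₁])
      (by rw [inner_neg_right, hve₁, neg_zero])
    have hv1 : ⟪v, c t₁⟫ = ⟪v, p⟫ := by
      rw [h1, inner_add_right, real_inner_smul_right, hve₁]; ring
    have hv2 : ⟪v, c t₂⟫ = ⟪v, p⟫ := by
      rw [h2, inner_add_right, real_inner_smul_right, inner_neg_right, hve₁]; ring
    have ht : t₁ = t₂ := by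
      rcases le_total t₁ t₂ with h | h
      · have := hX t₁ ht₁ t₂ ht₂ h
        rw [hv1, hv2] at this
        nlinarith
      · have := hX t₂ ht₂ t₁ ht₁ h
        rw [hv1, hv2] at this
        nlinarith
    have h3 : (τ₁ + τ₂) • e₁ = 0 := by
      have : p + τ₁ • e₁ = p + τ₂ • -e₁ := by rw [← h1, ← h2, ht]
      have := add_left_cancel this
      rw [add_smul, this]; simp
    have h4 : τ₁ + τ₂ = 0 := by
      rcases smul_eq_zero.1 h3 with h | h
      · exact h
      · rw [h, norm_zero] at he₁; norm_num at he₁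
    have h5 : τ₁ = 0 := by linarith
    rw [h5, zero_smul, add_zero] at h1
    exact hpF (h1 ▸ hcD ⟨t₁, rfl⟩)
  set S := (b + 2) * r with hS
  have hS0 : 0 < S := by positivity
  have hSr : r + S < R := by
    have : R = (b + 4) * r := by rw [hr]; field_simp
    rw [this, hS]; linarith
  have hseg_ball : segment ℝ p (p + S • e) ⊆ Metric.ball x₀ R := by
    refine (convex_ball x₀ R).segment_subset ?_ ?_
    · rw [mem_ball_iff_norm]; linarith
    · rw [mem_ball_iff_norm, add_sub_right_comm]
      refine (norm_add_le _ _).trans_lt ?_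
      rw [norm_smul, he, Real.norm_of_nonneg hS0.le]; linarith
  have hseg : segment ℝ p (p + S • e) ⊆ interior D := by
    refine (convex_segment _ _).isPreconnected.subset_interior_of_disjoint_frontier ?_
      ⟨p, left_mem_segment _ _ _, hpD⟩
    refine Set.disjoint_left.2 fun x hx hxD => ?_
    have hxa := harc ⟨hxD, hseg_ball hx⟩
    rw [segment_eq_image'] at hx
    obtain ⟨θ, hθ, rfl⟩ := hx
    simp only [add_sub_cancel_left, smul_smul] at hxa
    exact hup (θ * S) (mul_nonneg hθ.1 hS0.le) hxa
  have hpcone : p + S • e ∈ localCone x₀ v e b R := by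
    refine ⟨?_, hseg_ball (right_mem_segment _ _ _)⟩
    have h1 : ⟪v, p + S • e - x₀⟫ = ⟪v, p - x₀⟫ := by
      rw [add_sub_right_comm, inner_add_right, real_inner_smul_right, hve]; ring
    have h2 : ⟪e, p + S • e - x₀⟫ = ⟪e, p - x₀⟫ + S := by
      rw [add_sub_right_comm, inner_add_right, real_inner_smul_right, real_inner_self_eq_norm_sq,
        he]; ring
    have h3 := abs_real_inner_le_norm v (p - x₀)
    have h4 := (abs_le.1 (abs_real_inner_le_norm e (p - x₀))).1
    rw [hv, one_mul] at h3
    rw [he, one_mul] at h4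
    show b * _ < _
    rw [h1, h2]
    have : b * |⟪v, p - x₀⟫| ≤ b * r := by have := h3.trans hpball.le; gcongr
    rw [hS]; linarith
  have hconeD : localCone x₀ v e b R ⊆ interior D :=
    (convex_localCone x₀ v e hb0.le R).isPreconnected.subset_interior_of_disjoint_frontier
      (hcone e he) ⟨_, hpcone, hseg (right_mem_segment _ _ _)⟩
  refine ⟨e, he, 1 / (b + 1), by positivity, by rw [div_le_one (by positivity)]; linarith,
    R / 2, half_pos hR, fun ρ hρ hρR => Subset.trans ?_ (hconeD.trans interior_subset)⟩
  intro x hx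
  rw [mem_ball_iff_norm, ← sub_sub] at hx
  set κ := 1 / (b + 1) with hκ
  have hκ1 : κ ≤ 1 := by rw [hκ, div_le_one (by positivity)]; linarith
  have hκb : b * (κ * ρ) = ρ - κ * ρ := by rw [hκ]; field_simp; ring
  have h1 := (abs_real_inner_le_norm v (x - x₀ - ρ • e)).trans_lt (by rw [hv, one_mul]; exact hx)
  have h2 := (abs_real_inner_le_norm e (x - x₀ - ρ • e)).trans_lt (by rw [he, one_mul]; exact hx)
  rw [inner_sub_right, real_inner_smul_right, hve, mul_zero, sub_zero] at h1
  rw [inner_sub_right, real_inner_smul_right, real_inner_self_eq_norm_sq, he] at h2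
  refine ⟨?_, ?_⟩
  · show b * _ < _
    have h3 : b * |⟪v, x - x₀⟫| ≤ b * (κ * ρ) := by gcongr
    have h4 := (abs_lt.1 h2).1
    linarith
  · rw [mem_ball_iff_norm]
    have h5 : ‖x - x₀‖ ≤ ‖x - x₀ - ρ • e‖ + ‖ρ • e‖ := by
      simpa using norm_add_le (x - x₀ - ρ • e) (ρ • e)
    rw [norm_smul, he, Real.norm_of_nonneg hρ.le] at h5
    have h6 : κ * ρ ≤ 1 * ρ := by gcongr
    linarith

/-- The pixels inside the region keep a positive proportion of the total weight at a boundary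
point. -/
theorem AssumptionB2.exists_le_sum_weight {μ : Plane → ℝ} {d : ℝ} {D : Set Plane}
    {K : Plane → ℝ} (hB : AssumptionB2 μ d D) (hK : AssumptionB3 K)
    (hD : closure (interior D) = D) {x₀ : Plane} (hx₀ : x₀ ∈ frontier D) (hx₀' : x₀ ∈ openSquare)
    {h : ℕ → ℝ} (hpos : ∀ n, 0 < h n) (hh : Tendsto h atTop (𝓝 0))
    (hnh : Tendsto (fun n : ℕ => (n : ℝ) * h n) atTop atTop) :
    ∃ a > 0, ∀ᶠ n in atTop,
      a ≤ ∑ p, D.indicator (fun _ => weight K (h n) n x₀ p) (pixel n p.1 p.2) := by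
  obtain ⟨e, he, κ, hκ, hκ1, ρ₀, hρ₀, hball⟩ := hB.exists_ball_subset hD hx₀
  obtain ⟨C, hC⟩ := hK.lipschitz
  have hK0 := hK.pos
  set b := K 0 / 2 with hb
  have hb0 : 0 < b := half_pos hK0
  set r := min 1 (b / (C + 1)) with hr
  have hr0 : 0 < r := by positivity
  have hKr : ∀ u, ‖u‖ ≤ r → b ≤ K u := by
    intro u hu
    have h1 := hC.dist_le_mul u 0
    rw [Real.dist_eq, dist_zero_right] at h1
    have h2 : (C : ℝ) * ‖u‖ ≤ b := by
      calc (C : ℝ) * ‖u‖ ≤ (C + 1) * (b / (C + 1)) := by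
            have := hu.trans (min_le_right _ _)
            gcongr; linarith
        _ = b := by field_simp
    have h3 := (abs_le.1 h1).1
    linarith
  set r' := r / 2 with hr'
  have hr'0 : 0 < r' := half_pos hr0
  -- A tent below `K` supported on the reflected, rescaled ball inside the region.
  set ψ : Plane → ℝ := fun u => max 0 (b * (1 - ‖u + r' • e‖ / (κ * r'))) with hψ
  have hψ0 : ∀ u, 0 ≤ ψ u := fun u => le_max_left _ _
  have hψsupp : ∀ u, ψ u ≠ 0 → ‖u + r' • e‖ < κ * r' := by
    intro u hu
    by_contra hcon
    refine hu (max_eq_left ?_)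
    have : 1 ≤ ‖u + r' • e‖ / (κ * r') := by rw [one_le_div (by positivity)]; exact not_lt.1 hcon
    nlinarith
  have hψr : ∀ u, ψ u ≠ 0 → ‖u‖ ≤ r := by
    intro u hu
    have h1 := hψsupp u hu
    have h2 : ‖u‖ ≤ ‖u + r' • e‖ + ‖r' • e‖ := by
      simpa using norm_sub_le (u + r' • e) (r' • e)
    rw [norm_smul, he, Real.norm_of_nonneg hr'0.le] at h2
    have h3 : κ * r' ≤ 1 * r' := by gcongr
    linarith
  have hψK : ∀ u, ψ u ≤ K u := by
    intro u
    by_cases hu : ψ u = 0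
    · rw [hu]; exact hK.nonneg' u
    · refine le_trans (max_le hb0.le ?_) (hKr u (hψr u hu))
      have : 0 ≤ ‖u + r' • e‖ / (κ * r') := by positivity
      nlinarith
  have hψsupp2 : ∀ u, 2 ≤ ‖u‖ → ψ u = 0 := by
    intro u hu
    by_contra hcon
    have h1 := hψr u hcon
    have h2 : r ≤ 1 := min_le_left _ _
    linarith
  have hψlip : LipschitzWith (Real.toNNReal (b / (κ * r'))) ψ := by
    refine LipschitzWith.const_max ?_ 0
    refine LipschitzWith.of_dist_le_mul fun u w => ?_
    rw [Real.coe_toNNReal _ (by positivity), Real.dist_eq, dist_eq_norm]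
    have h1 := abs_norm_sub_norm_le (u + r' • e) (w + r' • e)
    rw [add_sub_add_right_eq_sub] at h1
    have e1 : b * (1 - ‖u + r' • e‖ / (κ * r')) - b * (1 - ‖w + r' • e‖ / (κ * r')) =
        -(b / (κ * r') * (‖u + r' • e‖ - ‖w + r' • e‖)) := by ring
    rw [e1, abs_neg, abs_mul, abs_of_pos (by positivity)]
    gcongr
  have hψint : 0 < ∫ u, ψ u := by
    refine hψlip.continuous.integral_pos_of_hasCompactSupport_nonneg_nonzero ?_ hψ0
      (x := -(r' • e)) ?_
    · refine HasCompactSupport.of_support_subset_isCompact (isCompact_closedBall 0 2) ?_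
      intro u hu
      rw [mem_closedBall_zero_iff]
      by_contra hcon
      exact hu (hψsupp2 u (not_le.1 hcon).le)
    · simp [hψ, hb0.ne', hb0.le]
  refine ⟨(∫ u, ψ u) / 2, half_pos hψint, ?_⟩
  filter_upwards [(tendsto_riemannSum hψlip hψsupp2 hx₀' hpos hh hnh).eventually
    (lt_mem_nhds (half_lt_self hψint)), hh.eventually (gt_mem_nhds (div_pos hρ₀ hr'0))] with n h1 h2
  refine h1.le.trans (Finset.sum_le_sum fun p _ => ?_)
  have hn := hpos n
  set u := (h n)⁻¹ • (x₀ - pixel n p.1 p.2) with hu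
  by_cases hψu : ψ u = 0
  · rw [hψu, mul_zero, mul_zero]
    exact indicator_nonneg (fun _ _ => hK.weight_nonneg _ _ _ _) _
  · have hpD : pixel n p.1 p.2 ∈ D := by
      refine hball (h n * r') (by positivity) ?_ ?_
      · rw [lt_div_iff₀ hr'0] at h2; exact h2.le
      · have h3 := hψsupp u hψu
        have e1 : pixel n p.1 p.2 - (x₀ + (h n * r') • e) = -(h n • (u + r' • e)) := by
          rw [smul_add, hu, smul_smul, smul_smul, mul_inv_cancel₀ hn.ne', one_smul]; abel
        rw [mem_ball_iff_norm, e1, norm_neg, norm_smul, Real.norm_of_nonneg hn.le]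
        calc h n * ‖u + r' • e‖ < h n * (κ * r') := by gcongr
          _ = _ := by ring
    rw [indicator_of_mem hpD, weight]
    have := hψK u
    gcongr

/-! ### The law of the noise -/

/-- The law on `ℝ` with density `f`. -/
noncomputable def noiseLaw (f : ℝ → ℝ) : Measure ℝ :=
  volume.withDensity fun y => ENNReal.ofReal (f y)

theorem noiseLaw_absolutelyContinuous (f : ℝ → ℝ) : noiseLaw f ≪ volume :=
  withDensity_absolutelyContinuous _ _

theorem IsIIDNoise.isProbabilityMeasure_noiseLaw {Ω : Type*} [MeasurableSpace Ω] {P : Measure Ω}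
    [IsProbabilityMeasure P] {ε : (n : ℕ) → Fin n → Fin n → Ω → ℝ} {f : ℝ → ℝ}
    (hε : IsIIDNoise P ε f) : IsProbabilityMeasure (noiseLaw f) := by
  rw [noiseLaw, ← hε.law 1 0 0]
  exact Measure.isProbabilityMeasure_map (hε.measurable 1 0 0).aemeasurable

theorem integral_noiseLaw {f : ℝ → ℝ} (hfm : Measurable f) (hf0 : ∀ y, 0 ≤ f y) (G : ℝ → ℝ) :
    ∫ u, G u ∂noiseLaw f = ∫ u, f u * G u := by
  rw [noiseLaw, integral_withDensity_eq_integral_toReal_smul hfm.ennreal_ofReal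
    (Eventually.of_forall fun _ => ENNReal.ofReal_lt_top)]
  simp only [ENNReal.toReal_ofReal (hf0 _), smul_eq_mul]

theorem integrable_density {f : ℝ → ℝ} (hfm : Measurable f) (hf0 : ∀ y, 0 ≤ f y)
    [IsProbabilityMeasure (noiseLaw f)] : Integrable f := by
  refine ⟨hfm.aestronglyMeasurable, ?_⟩
  rw [hasFiniteIntegral_iff_ofReal (Eventually.of_forall hf0)]
  have : noiseLaw f univ = ∫⁻ y, ENNReal.ofReal (f y) := by
    rw [noiseLaw, withDensity_apply _ MeasurableSet.univ, Measure.restrict_univ]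
  rw [← this, measure_univ]
  exact ENNReal.one_lt_top

theorem not_ae_eq_zero_density (f : ℝ → ℝ) [IsProbabilityMeasure (noiseLaw f)] :
    ¬ f =ᵐ[volume] 0 := by
  intro h
  have h1 : noiseLaw f = 0 := by
    rw [noiseLaw, withDensity_congr_ae (g := 0), withDensity_zero]
    filter_upwards [h] with y hy
    simp [hy]
  have h2 := measure_univ (μ := noiseLaw f)
  rw [h1] at h2
  simp at h2

theorem noiseLaw_compl_eq_zero {f : ℝ → ℝ} {s : Set ℝ} (hs : MeasurableSet s)
    (h : ∀ y ∉ s, f y = 0) : noiseLaw f sᶜ = 0 := by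
  rw [noiseLaw, withDensity_apply _ hs.compl, setLIntegral_congr_fun hs.compl (g := fun _ => 0),
    lintegral_zero]
  intro y hy
  simp [h y hy]

theorem noiseLaw_compl_interior {f : ℝ → ℝ} {I : Set ℝ} (hI : I.OrdConnected)
    (h : ∀ y ∉ I, f y = 0) : noiseLaw f (interior I)ᶜ = 0 := by
  have hsub : (interior I)ᶜ ⊆ Iᶜ ∪ frontier I := by
    intro y hy
    by_cases hyI : y ∈ I
    · exact Or.inr ⟨subset_closure hyI, hy⟩
    · exact Or.inl hyI
  refine measure_mono_null hsub (measure_union_null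
    (noiseLaw_compl_eq_zero hI.measurableSet h) ?_)
  exact noiseLaw_absolutelyContinuous f (hI.convex.addHaar_frontier volume)

theorem IsLimitSlope.inter {ν : Measure ℝ} {L : ℝ → ℝ} {h g : ℕ → ℝ} {φ : ℝ → ℝ} {I J : Set ℝ}
    (hS : IsLimitSlope ν L h g φ I) (hJ : IsOpen J) (hJc : J.OrdConnected) (h0 : (0 : ℝ) ∈ J)
    (hν : ν Jᶜ = 0) : IsLimitSlope ν L h g φ (I ∩ J) :=
  { hS with
    isOpen := hS.isOpen.inter hJ
    ordConnected := hS.ordConnected.inter hJc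
    zero_mem := ⟨hS.zero_mem, h0⟩
    carrier := by rw [compl_inter]; exact measure_union_null hS.carrier hν
    pos := fun z hz => hS.pos z hz.1
    neg := fun z hz => hS.neg z hz.1 }

/-! ### Vanishing scale parameter -/

/-- An integrable differentiable nonnegative function without critical points on the part of the
positive half-line where it is nonzero decreases there: otherwise it would have to come down again
and so have a further local maximum. -/
theorem deriv_nonpos_of_no_critical_point {f : ℝ → ℝ} (hd : Differentiable ℝ f)
    (hf0 : ∀ y, 0 ≤ f y) (hint : Integrable f) (hne : ∀ p, 0 < p → f p ≠ 0 → deriv f p ≠ 0)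
    {y : ℝ} (hy : 0 < y) : deriv f y ≤ 0 := by
  by_contra hcon
  rw [not_le] at hcon
  have h1 : ∀ᶠ x in 𝓝[>] y, 0 < slope f y x :=
    ((hasDerivAt_iff_tendsto_slope.1 (hd y).hasDerivAt).mono_left
      (nhdsWithin_mono _ fun x hx => ne_of_gt hx)).eventually (lt_mem_nhds hcon)
  obtain ⟨y', hslope, hyy'⟩ := (h1.and self_mem_nhdsWithin).exists
  rw [slope_def_field] at hslope
  have hfy : f y < f y' := by
    by_contra hle
    have := div_nonpos_of_nonpos_of_nonneg (sub_nonpos.2 (not_lt.1 hle)) (sub_pos.2 hyy').le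
    linarith
  obtain ⟨t, ht, hft⟩ : ∃ t, y' < t ∧ f t < f y' := by
    by_contra hall
    push Not at hall
    have h2 : IntegrableOn (fun _ : ℝ => f y') (Ioi y') := by
      refine Integrable.mono hint.integrableOn aestronglyMeasurable_const ?_
      filter_upwards [ae_restrict_mem measurableSet_Ioi] with t ht
      rw [Real.norm_of_nonneg (hf0 _), Real.norm_of_nonneg (hf0 _)]
      exact hall t ht
    rw [integrableOn_const_iff] at h2
    rcases h2 with h | h
    · have := hf0 y; rw [enorm_eq_zero.1 h] at hfy; linarith
    · rw [Real.volume_Ioi] at h; exact lt_irrefl _ h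
  obtain ⟨p, hp, hmax⟩ := isCompact_Icc.exists_isMaxOn (nonempty_Icc.2 (hyy'.trans ht).le)
    hd.continuous.continuousOn
  have hpy' : f y' ≤ f p := hmax ⟨hyy'.le, ht.le⟩
  have hp1 : y < p := lt_of_le_of_ne hp.1 (by rintro rfl; linarith)
  have hp2 : p < t := lt_of_le_of_ne hp.2 (by rintro rfl; linarith)
  have hloc : IsLocalMax f p := hmax.isLocalMax (Icc_mem_nhds hp1 hp2)
  exact hne p (hy.trans hp1) (by have := hf0 y; linarith) hloc.deriv_eq_zero

/-- Under `AssumptionA1` the density has a single peak, at `0`. -/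
theorem AssumptionA1.exists_peak {f : ℝ → ℝ} (hA : AssumptionA1 f) (hf0 : ∀ y, 0 ≤ f y)
    (hint : Integrable f) (hnz : ¬ f =ᵐ[volume] 0) :
    ∃ I : Set ℝ, I.OrdConnected ∧ (∀ y ∉ I, f y = 0) ∧ (∀ y ∈ I, y < 0 → 0 < deriv f y) ∧
      (∀ y ∈ I, 0 < y → deriv f y < 0) ∧ (∀ y, f y ≤ f 0) ∧ 0 < f 0 := by
  obtain ⟨I, hI, hzero, hd, -, hne⟩ := hA
  have hmemI : ∀ p, f p ≠ 0 → p ∈ I := fun p hp => by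
    by_contra h; exact hp (hzero p h)
  have hright : ∀ y, 0 < y → deriv f y ≤ 0 := fun y hy =>
    deriv_nonpos_of_no_critical_point hd hf0 hint
      (fun p hp hfp => hne p (hmemI p hfp) hp.ne') hy
  have hleft : ∀ y, y < 0 → 0 ≤ deriv f y := by
    intro y hy
    have := deriv_nonpos_of_no_critical_point (f := fun y => f (-y)) (hd.comp differentiable_neg)
      (fun y => hf0 _) hint.comp_neg
      (fun p hp hfp => by
        rw [deriv_comp_neg]
        exact neg_ne_zero.2 (hne (-p) (hmemI _ hfp) (by linarith))) (neg_pos.2 hy)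
    rw [deriv_comp_neg, neg_neg] at this
    linarith
  have hmax : ∀ y, f y ≤ f 0 := by
    intro y
    rcases le_total 0 y with h | h
    · have : AntitoneOn f (Ici 0) := antitoneOn_of_deriv_nonpos (convex_Ici 0)
        hd.continuous.continuousOn hd.differentiableOn
        (fun x hx => hright x (by simpa using hx))
      exact this self_mem_Ici h h
    · have : MonotoneOn f (Iic 0) := monotoneOn_of_deriv_nonneg (convex_Iic 0)
        hd.continuous.continuousOn hd.differentiableOn
        (fun x hx => hleft x (by simpa using hx))
      exact this h self_mem_Iic h
  refine ⟨I, hI, hzero, fun y hy h => lt_of_le_of_ne (hleft y h) (hne y hy h.ne).symm,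
    fun y hy h => lt_of_le_of_ne (hright y h) (hne y hy h.ne'), hmax, ?_⟩
  by_contra hcon
  refine hnz (Eventually.of_forall fun y => ?_)
  have h1 := hmax y
  have h2 := hf0 y
  show f y = 0
  linarith

theorem exists_bound_of_lipschitz_of_integrable {G : ℝ → ℝ} {C : NNReal} (hG : LipschitzWith C G)
    (hint : Integrable G) : ∃ M, ∀ v, |G v| ≤ M := by
  refine ⟨(∫ t, |G t|) + C, fun v => ?_⟩
  have h1 : ∀ t ∈ Icc v (v + 1), |G v| ≤ |G t| + C := by
    intro t ht
    have h2 := hG.dist_le_mul v t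
    rw [Real.dist_eq, Real.dist_eq] at h2
    have h3 : |v - t| ≤ 1 := by rw [abs_le]; constructor <;> linarith [ht.1, ht.2]
    have h4 : (C : ℝ) * |v - t| ≤ C * 1 := by gcongr
    have h5 := abs_sub_abs_le_abs_sub (G v) (G t)
    linarith
  have hvol : volume.real (Icc v (v + 1)) = 1 := by simp
  have hfin : volume (Icc v (v + 1)) ≠ ⊤ := by simp
  have hi : IntegrableOn (fun t => |G t| + C) (Icc v (v + 1)) :=
    hint.abs.integrableOn.add (integrableOn_const hfin)
  calc |G v| = ∫ _ in Icc v (v + 1), |G v| := by rw [setIntegral_const, hvol, one_smul]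
    _ ≤ ∫ t in Icc v (v + 1), (|G t| + C) :=
      setIntegral_mono_on (integrableOn_const hfin) hi measurableSet_Icc h1
    _ = (∫ t in Icc v (v + 1), |G t|) + C := by
      rw [integral_add hint.abs.integrableOn (integrableOn_const hfin), setIntegral_const, hvol,
        one_smul]
    _ ≤ _ := by
      have := setIntegral_le_integral (s := Icc v (v + 1)) hint.abs
        (Eventually.of_forall fun t => abs_nonneg _)
      linarith

theorem integrable_of_integrable_mul_abs {G : ℝ → ℝ} (hG : Continuous G)
    (hint : Integrable fun v => G v * |v|) : Integrable G := by
  have h1 : IntegrableOn G (Icc (-1) 1) := hG.continuousOn.integrableOn_compact isCompact_Icc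
  have h2 : IntegrableOn G (Icc (-1) 1)ᶜ := by
    refine Integrable.mono hint.integrableOn hG.aestronglyMeasurable ?_
    filter_upwards [ae_restrict_mem measurableSet_Icc.compl] with v hv
    have h3 : 1 ≤ |v| := by
      by_contra hcon
      have := abs_lt.1 (not_le.1 hcon)
      exact hv ⟨this.1.le, this.2.le⟩
    rw [norm_mul, Real.norm_eq_abs |v|, abs_abs]
    exact le_mul_of_one_le_right (norm_nonneg _) h3
  rw [← integrableOn_univ, ← union_compl_self (Icc (-1 : ℝ) 1)]
  exact h1.union h2

theorem integral_comp_const_sub_div (F : ℝ → ℝ) {g : ℝ} (hg : 0 < g) (z : ℝ) :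
    ∫ u, F ((z - u) / g) = g * ∫ v, F v := by
  rw [integral_sub_left_eq_self (fun t => F (t / g)) volume z, Measure.integral_comp_div,
    abs_of_pos hg, smul_eq_mul]

theorem integrable_comp_const_sub_div {F : ℝ → ℝ} (hF : Integrable F) {g : ℝ} (hg : 0 < g)
    (z : ℝ) : Integrable fun u => F ((z - u) / g) :=
  (hF.comp_div hg.ne').comp_sub_left z

namespace AssumptionB4

variable {L : ℝ → ℝ}

theorem integrable (hL : AssumptionB4 L) : Integrable L := by
  by_contra h
  have := hL.integral
  rw [integral_undef h] at this
  exact zero_ne_one this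

theorem continuous_deriv (hL : AssumptionB4 L) : Continuous (deriv L) :=
  hL.lipschitz_deriv.choose_spec.continuous

theorem integrable_deriv (hL : AssumptionB4 L) : Integrable (deriv L) :=
  integrable_of_integrable_mul_abs hL.continuous_deriv hL.integrable_deriv_mul_abs

theorem bounded_deriv (hL : AssumptionB4 L) : ∃ M, ∀ v, |deriv L v| ≤ M :=
  exists_bound_of_lipschitz_of_integrable hL.lipschitz_deriv.choose_spec hL.integrable_deriv

theorem exists_second_moment (hL : AssumptionB4 L) {f : ℝ → ℝ} (hfm : Measurable f)
    (hf0 : ∀ y, 0 ≤ f y) (hmax : ∀ y, f y ≤ f 0) {g : ℝ} (hg : 0 < g) (z : ℝ) :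
    ∫ u, deriv L ((z - u) / g) ^ 2 ∂noiseLaw f ≤ f 0 * (∫ v, deriv L v ^ 2) * g := by
  obtain ⟨M, hM⟩ := hL.bounded_deriv
  have hsq : Integrable fun v => deriv L v ^ 2 := by
    simp_rw [sq]
    exact hL.integrable_deriv.bdd_mul hL.continuous_deriv.aestronglyMeasurable
      (Eventually.of_forall fun v => hM v)
  rw [integral_noiseLaw hfm hf0]
  have hi := integrable_comp_const_sub_div hsq hg z
  calc _ ≤ ∫ u, f 0 * deriv L ((z - u) / g) ^ 2 :=
        integral_mono_of_nonneg (Eventually.of_forall fun u => mul_nonneg (hf0 _) (sq_nonneg _))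
          (hi.const_mul _)
          (Eventually.of_forall fun u => mul_le_mul_of_nonneg_right (hmax u) (sq_nonneg _))
    _ = _ := by
      rw [integral_const_mul, integral_comp_const_sub_div (fun v => deriv L v ^ 2) hg]; ring

/-- The mean slope is the derivative of the smoothed density, at distance `O(g)` from the
derivative of the density. -/
theorem abs_meanSlope_sub_deriv_le (hL : AssumptionB4 L) {f : ℝ → ℝ} (hd : Differentiable ℝ f)
    (hf0 : ∀ y, 0 ≤ f y) (hint : Integrable f) {C : NNReal} (hC : LipschitzWith C (deriv f))
    (hmax : ∀ y, f y ≤ f 0) {g : ℝ} (hg : 0 < g) (z : ℝ) :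
    |meanSlope L (noiseLaw f) g z - deriv f z| ≤ C * (∫ v, L v * |v|) * g := by
  obtain ⟨M, hM⟩ := hL.bounded_deriv
  set V : ℝ → ℝ := fun u => L ((z - u) / g) with hV
  have hVd : ∀ u, HasDerivAt V (deriv L ((z - u) / g) * (-1 / g)) u := by
    intro u
    have h1 : HasDerivAt (fun u : ℝ => (z - u) / g) (-1 / g) u :=
      ((hasDerivAt_id u).const_sub z).div_const g
    exact (hL.differentiable _).hasDerivAt.comp u h1
  have hVint : Integrable V := integrable_comp_const_sub_div hL.integrable hg z
  have hVabs : Integrable fun u => V u * |u - z| := by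
    have h1 := (integrable_comp_const_sub_div hL.integrable_mul_abs hg z).const_mul g
    refine h1.congr (Eventually.of_forall fun u => ?_)
    simp only [hV]
    rw [abs_div, abs_of_pos hg, abs_sub_comm]
    field_simp
  have hVcont : Continuous V := by
    have := hL.differentiable.continuous
    fun_prop
  have hf'c : Continuous (deriv f) := hC.continuous
  have hlip : ∀ u, |deriv f u - deriv f z| ≤ C * |u - z| := fun u => by
    have := hC.dist_le_mul u z
    rwa [Real.dist_eq, Real.dist_eq] at this
  have hdiff : Integrable fun u => V u * (deriv f u - deriv f z) := by
    refine Integrable.mono (hVabs.const_mul (C : ℝ)) (by fun_prop)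
      (Eventually.of_forall fun u => ?_)
    rw [norm_mul, norm_mul, norm_mul, Real.norm_eq_abs |u - z|, abs_abs,
      Real.norm_of_nonneg C.coe_nonneg]
    calc _ ≤ ‖V u‖ * (C * |u - z|) := by
          have := hlip u
          rw [← Real.norm_eq_abs] at this
          gcongr
      _ = _ := by ring
  have hf'V : Integrable (deriv f * V) := by
    refine (hdiff.add (hVint.const_mul (deriv f z))).congr (Eventually.of_forall fun u => ?_)
    simp only [Pi.add_apply, Pi.mul_apply]; ring
  have hfV' : Integrable (f * fun u => deriv L ((z - u) / g) * (-1 / g)) := by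
    refine hint.mul_bdd (c := M * |(-1 / g)|) ?_ (Eventually.of_forall fun u => ?_)
    · have := hL.continuous_deriv
      exact (by fun_prop :
        Continuous fun u => deriv L ((z - u) / g) * (-1 / g)).aestronglyMeasurable
    · rw [norm_mul]
      exact mul_le_mul_of_nonneg_right (hM _) (abs_nonneg _)
  have hfV : Integrable (f * V) := by
    refine hVint.bdd_mul (c := f 0) hd.continuous.aestronglyMeasurable
      (Eventually.of_forall fun u => ?_)
    rw [Real.norm_of_nonneg (hf0 u)]
    exact hmax u
  have hparts := integral_mul_deriv_eq_deriv_mul_of_integrable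
    (fun u _ => (hd u).hasDerivAt) (fun u _ => hVd u) hfV' hf'V hfV
  have hmean : meanSlope L (noiseLaw f) g z = 1 / g * ∫ u, V u * deriv f u := by
    rw [meanSlope, integral_noiseLaw hd.continuous.measurable hf0]
    calc _ = (-1 / g) * ∫ u, f u * (deriv L ((z - u) / g) * (-1 / g)) := by
          rw [← integral_const_mul]
          congr 1; ext u
          rw [kernelSlope]; field_simp
      _ = _ := by
          rw [hparts]
          simp_rw [mul_comm (deriv f _)]
          ring
  have hone : deriv f z = 1 / g * ∫ u, V u * deriv f z := by
    rw [integral_mul_const, integral_comp_const_sub_div L hg, hL.integral]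
    field_simp
  have hVf' : Integrable fun u => V u * deriv f u :=
    hf'V.congr (Eventually.of_forall fun u => by simp only [Pi.mul_apply]; ring)
  have hdiff' : meanSlope L (noiseLaw f) g z - deriv f z =
      1 / g * ∫ u, V u * (deriv f u - deriv f z) := by
    conv_lhs => rw [hmean, hone]
    rw [← mul_sub, ← integral_sub hVf' (hVint.mul_const _)]
    simp_rw [mul_sub]
  rw [hdiff', abs_mul, abs_of_pos (by positivity)]
  calc _ ≤ 1 / g * ∫ u, C * (V u * |u - z|) := by
        refine mul_le_mul_of_nonneg_left ?_ (by positivity)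
        refine abs_integral_le_integral_abs.trans (integral_mono hdiff.abs (hVabs.const_mul _)
          fun u => ?_)
        simp only
        rw [abs_mul, abs_of_nonneg (hL.nonneg _)]
        have := mul_le_mul_of_nonneg_left (hlip u) (hL.nonneg ((z - u) / g))
        linarith
    _ = 1 / g * (C * (g * (g * ∫ v, L v * |v|))) := by
        have e : ∫ u, V u * |u - z| = ∫ u, g * (fun v => L v * |v|) ((z - u) / g) := by
          refine integral_congr_ae (Eventually.of_forall fun u => ?_)
          simp only [hV]
          rw [abs_div, abs_of_pos hg, abs_sub_comm]
          field_simp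
        rw [integral_const_mul, e, integral_const_mul,
          integral_comp_const_sub_div (fun v => L v * |v|) hg z]
    _ = _ := by field_simp

end AssumptionB4

theorem tendsto_inv_mul_inv {h : ℕ → ℝ} (hpos : ∀ n, 0 < h n)
    (hr : Tendsto (fun n : ℕ => (n : ℝ)⁻¹ * (h n)⁻¹) atTop (𝓝 0)) :
    Tendsto (fun n : ℕ => (n : ℝ) * h n) atTop atTop := by
  have h1 : Tendsto (fun n : ℕ => (n : ℝ)⁻¹ * (h n)⁻¹) atTop (𝓝[>] 0) := by
    refine tendsto_nhdsWithin_iff.2 ⟨hr, ?_⟩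
    filter_upwards [eventually_gt_atTop 0] with n hn
    have : (0 : ℝ) < n := by exact_mod_cast hn
    have := hpos n
    exact mem_Ioi.2 (by positivity)
  refine h1.inv_tendsto_nhdsGT_zero.congr fun n => ?_
  simp [mul_comm]

namespace AssumptionB5

variable {h g : ℕ → ℝ}

theorem pixels (hB : AssumptionB5 h g) : Tendsto (fun n : ℕ => (n : ℝ) * h n) atTop atTop := by
  refine tendsto_inv_mul_inv hB.h_pos ?_
  have h1 := hB.rate_h.mul hB.h_tendsto
  rw [zero_mul] at h1
  refine h1.congr fun n => ?_
  have := (hB.h_pos n).ne'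
  field_simp

/-- As `n h g² → ∞`, the exponent `(n h)² g³ = (n h g²)² / g` exceeds `1 / g`. -/
theorem rate (hB : AssumptionB5 h g) {c : ℝ} (hc : 0 < c) :
    Tendsto (fun n : ℕ => (g n)⁻¹ ^ 3 * Real.exp (-(c * ((n * h n) ^ 2 * g n ^ 3)))) atTop
      (𝓝 0) := by
  have hg : Tendsto (fun n => (g n)⁻¹) atTop atTop :=
    (tendsto_nhdsWithin_iff.2 ⟨hB.g_tendsto,
      Eventually.of_forall fun n => mem_Ioi.2 (hB.g_pos n)⟩).inv_tendsto_nhdsGT_zero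
  have hbig : Tendsto (fun n : ℕ => (n : ℝ) * (h n * g n ^ 2)) atTop atTop := by
    refine tendsto_inv_mul_inv (fun n => mul_pos (hB.h_pos n) (pow_pos (hB.g_pos n) 2))
      (hB.rate_g.congr fun n => ?_)
    rw [mul_inv, inv_pow, mul_assoc]
  have h1 := ((Real.tendsto_pow_mul_exp_neg_atTop_nhds_zero 3).comp
    (hg.const_mul_atTop hc)).const_mul (c⁻¹ ^ 3)
  rw [mul_zero] at h1
  refine squeeze_zero' (Eventually.of_forall fun n => ?_) ?_ h1
  · have := hB.g_pos n; positivity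
  · filter_upwards [hbig.eventually_ge_atTop 1] with n hn
    have hgn := hB.g_pos n
    have h2 : (g n)⁻¹ ≤ (n * h n) ^ 2 * g n ^ 3 := by
      have h3 : 1 ≤ (n * (h n * g n ^ 2)) ^ 2 := one_le_pow₀ hn
      rw [inv_le_iff_one_le_mul₀ hgn]
      calc (1 : ℝ) ≤ _ := h3
        _ = _ := by ring
    calc _ ≤ (g n)⁻¹ ^ 3 * Real.exp (-(c * (g n)⁻¹)) := by gcongr
      _ = _ := by
        simp only [Function.comp, mul_pow]
        field_simp

end AssumptionB5

/-- For a vanishing scale parameter the limiting slope is the derivative of the density. -/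
theorem AssumptionA1.isLimitSlope {f L : ℝ → ℝ} {h g : ℕ → ℝ} (hA : AssumptionA1 f)
    (hfm : Measurable f) (hf0 : ∀ y, 0 ≤ f y) [IsProbabilityMeasure (noiseLaw f)]
    (hL : AssumptionB4 L) (hB : AssumptionB5 h g) :
    ∃ I, IsLimitSlope (noiseLaw f) L h g (deriv f) I ∧ 0 < f 0 := by
  have hint := integrable_density hfm hf0
  obtain ⟨I, hI, hzero, hpos, hneg, hmax, h00⟩ := hA.exists_peak hf0 hint (not_ae_eq_zero_density f)
  obtain ⟨-, -, -, hd, ⟨C, hC⟩, -⟩ := hA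
  refine ⟨interior I, ?_, h00⟩
  exact
    { differentiable := hL.differentiable
      lipschitz_deriv := hL.lipschitz_deriv
      bounded_deriv := hL.bounded_deriv
      second_moment := ⟨_, fun n z => hL.exists_second_moment hfm hf0 hmax (hB.g_pos n) z⟩
      h_pos := hB.h_pos
      g_pos := hB.g_pos
      h_tendsto := hB.h_tendsto
      g_bounded := by
        obtain ⟨B, hB⟩ := hB.g_tendsto.bddAbove_range
        exact ⟨B, fun n => hB ⟨n, rfl⟩⟩
      pixels := hB.pixels
      rate := fun c hc => hB.rate hc
      limit := by
        intro τ hτ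
        have h1 := hB.g_tendsto.const_mul (C * ∫ v, L v * |v|)
        rw [mul_zero] at h1
        filter_upwards [h1.eventually (gt_mem_nhds hτ)] with n hn z
        exact (hL.abs_meanSlope_sub_deriv_le hd hf0 hint hC hmax (hB.g_pos n) z).trans hn.le
      lipschitz := ⟨C, hC⟩
      isOpen := isOpen_interior
      ordConnected := hI.interior
      zero_mem := by
        refine interior_maximal (fun y hy => ?_) (isOpen_Ioi.preimage hd.continuous) h00
        by_contra hcon
        have : 0 < f y := hy
        rw [hzero y hcon] at this
        exact lt_irrefl _ this
      carrier := noiseLaw_compl_interior hI hzero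
      pos := fun z hz => hpos z (interior_subset hz)
      neg := fun z hz => hneg z (interior_subset hz) }

/-! ### Fixed scale parameter -/

namespace AssumptionB4'

variable {L : ℝ → ℝ}

theorem deriv_neg (hL : AssumptionB4' L) (v : ℝ) : deriv L (-v) = -deriv L v := by
  have h1 : (fun v => L (-v)) = L := funext hL.symmetric
  have h2 := deriv_comp_neg L v
  rw [h1] at h2
  rw [h2, neg_neg]

theorem deriv_zero (hL : AssumptionB4' L) : deriv L 0 = 0 := by
  have := hL.deriv_neg 0
  rw [neg_zero] at this
  linarith

theorem deriv_eq_zero (hL : AssumptionB4' L) {v : ℝ} (hv : 1 ≤ |v|) : deriv L v = 0 := by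
  have hLv : L v = 0 := hL.eq_zero v fun h => by
    have := abs_lt.2 h
    linarith
  exact IsLocalMin.deriv_eq_zero (Eventually.of_forall fun w => by
    show L v ≤ L w
    rw [hLv]; exact hL.nonneg w)

theorem deriv_lt_zero (hL : AssumptionB4' L) {v : ℝ} (h0 : 0 < v) (h1 : v < 1) :
    deriv L v < 0 := by
  have := hL.deriv_pos (-v) ⟨by linarith, by linarith⟩
  rw [hL.deriv_neg] at this
  linarith

theorem deriv_nonpos (hL : AssumptionB4' L) {v : ℝ} (h0 : 0 < v) : deriv L v ≤ 0 := by
  rcases lt_or_ge v 1 with h | h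
  · exact (hL.deriv_lt_zero h0 h).le
  · exact (hL.deriv_eq_zero (h.trans (le_abs_self v))).le

theorem bounded_deriv (hL : AssumptionB4' L) : ∃ M, ∀ v, |deriv L v| ≤ M := by
  obtain ⟨C, hC⟩ := hL.lipschitz_deriv
  refine ⟨C, fun v => ?_⟩
  rcases le_total 1 |v| with h | h
  · rw [hL.deriv_eq_zero h, abs_zero]; exact C.coe_nonneg
  · have h1 := hC.dist_le_mul v 0
    rw [Real.dist_eq, Real.dist_eq, hL.deriv_zero, sub_zero, sub_zero] at h1
    calc _ ≤ _ := h1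
      _ ≤ C * 1 := by gcongr
      _ = C := mul_one _

end AssumptionB4'

/-- Smoothing with an even unimodal kernel keeps a density that falls from `0` on and is
symmetric on the window strictly falling: pairing the points `z - t` and `z + t`, the former is
nearer to the peak or has its mirror image nearer to it. -/
theorem integral_mul_deriv_neg_of_pos {f L : ℝ → ℝ} {I : Set ℝ} {g z : ℝ} (hL : AssumptionB4' L)
    (hg : 0 < g) (hint : Integrable f) (hf0 : ∀ y, 0 ≤ f y) (hI : I.OrdConnected)
    (h0 : (0 : ℝ) ∈ I) (hzero : ∀ y ∉ I, f y = 0) (hsym : ∀ y ∈ Icc (-g) g, f (-y) = f y)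
    (hanti : StrictAntiOn f (Ioi 0 ∩ I)) (hz : 0 < z) (hzI : z ∈ interior I) :
    ∫ u, f u * deriv L ((z - u) / g) < 0 := by
  obtain ⟨C, hC⟩ := hL.lipschitz_deriv
  have hLc := hC.continuous
  obtain ⟨M, hM⟩ := hL.bounded_deriv
  set G : ℝ → ℝ := fun t => deriv L (t / g) with hG
  have hGc : Continuous G := by fun_prop
  have hGodd : ∀ t, G (-t) = -G t := fun t => by
    simp only [hG]; rw [neg_div, hL.deriv_neg]
  have hi1 : Integrable fun t => f (z - t) * G t :=
    (hint.comp_sub_left z).mul_bdd hGc.aestronglyMeasurable (Eventually.of_forall fun t => hM _)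
  have hi2 : Integrable fun t => f (z + t) * G t :=
    (hint.comp_add_left z).mul_bdd hGc.aestronglyMeasurable (Eventually.of_forall fun t => hM _)
  have e1 : ∫ u, f u * deriv L ((z - u) / g) = ∫ t, f (z - t) * G t := by
    rw [← integral_sub_left_eq_self (fun t => f (z - t) * G t) volume z]
    simp only [sub_sub_cancel, hG]
  have e2 : ∫ t, f (z - t) * G t = -∫ t, f (z + t) * G t := by
    rw [← integral_neg_eq_self (fun t => f (z - t) * G t), ← integral_neg]
    simp only [sub_neg_eq_add, hGodd, mul_neg]
  set q : ℝ → ℝ := fun t => f (z + t) * G t - f (z - t) * G t with hq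
  have hqi : Integrable q := hi2.sub hi1
  have hqint : ∫ t, q t = -2 * ∫ u, f u * deriv L ((z - u) / g) := by
    rw [hq, integral_sub hi2 hi1, e1]; linarith
  have hqeven : ∀ t, q (-t) = q t := fun t => by
    simp only [hq, hGodd, sub_neg_eq_add, ← sub_eq_add_neg]; ring
  have hweak : ∀ w s, 0 < w → w < s → f s ≤ f w := by
    intro w s hw hws
    by_cases hs : s ∈ I
    · exact (hanti ⟨hw, hI.out h0 hs ⟨hw.le, hws.le⟩⟩ ⟨hw.trans hws, hs⟩ hws).le
    · rw [hzero s hs]; exact hf0 w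
  have hqpos : ∀ t, 0 < t → t ≠ z → 0 ≤ q t := by
    intro t ht htz
    have hGt : G t ≤ 0 := hL.deriv_nonpos (div_pos ht hg)
    rcases le_or_gt g t with hgt | hgt
    · have : G t = 0 := hL.deriv_eq_zero (by
        rw [abs_of_pos (div_pos ht hg)]; exact (one_le_div hg).2 hgt)
      simp only [hq, this]; simp
    · have hle : f (z + t) ≤ f (z - t) := by
        rcases lt_or_gt_of_ne htz with h | h
        · exact hweak _ _ (by linarith) (by linarith)
        · have := hsym (t - z) ⟨by linarith, by linarith⟩
          rw [neg_sub] at this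
          rw [this]
          exact hweak _ _ (by linarith) (by linarith)
      simp only [hq]
      nlinarith
  have hnn : 0 ≤ᵐ[volume] q := by
    have hfin : volume ({0, z, -z} : Set ℝ) = 0 := (Set.toFinite _).measure_zero _
    filter_upwards [measure_eq_zero_iff_ae_notMem.1 hfin] with t ht
    simp only [mem_insert_iff, mem_singleton_iff, not_or] at ht
    obtain ⟨h1, h2, h3⟩ := ht
    show 0 ≤ q t
    rcases lt_or_gt_of_ne h1 with h | h
    · rw [← hqeven]
      exact hqpos _ (by linarith) fun h4 => h3 (by linarith)
    · exact hqpos _ h h2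
  obtain ⟨τ, hτ, hball⟩ := Metric.isOpen_iff.1 isOpen_interior z hzI
  have hsupp : Ioo 0 (min (min z g) τ) ⊆ Function.support q := by
    rintro t ⟨ht, ht'⟩
    rw [lt_min_iff, lt_min_iff] at ht'
    obtain ⟨⟨htz, htg⟩, htτ⟩ := ht'
    have hzt : z + t ∈ I := interior_subset (hball (by
      rw [Metric.mem_ball, Real.dist_eq, add_sub_cancel_left, abs_of_pos ht]; exact htτ))
    have hlt : f (z + t) < f (z - t) :=
      hanti ⟨by simp only [mem_Ioi]; linarith, hI.out h0 hzt ⟨by linarith, by linarith⟩⟩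
        ⟨by simp only [mem_Ioi]; linarith, hzt⟩ (by linarith)
    have hGt : G t < 0 := hL.deriv_lt_zero (div_pos ht hg) ((div_lt_one hg).2 htg)
    have : 0 < q t := by simp only [hq]; nlinarith
    exact this.ne'
  have hpos : 0 < ∫ t, q t := by
    rw [integral_pos_iff_support_of_nonneg_ae hnn hqi]
    refine lt_of_lt_of_le ?_ (measure_mono hsupp)
    rw [Real.volume_Ioo, ENNReal.ofReal_pos]
    have : 0 < min (min z g) τ := lt_min (lt_min hz hg) hτ
    linarith
  linarith

/-- If the density vanished on the positive half-line then, by symmetry on the window and strict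
monotonicity, it would vanish everywhere off `0`. -/
theorem exists_pos_mem_of_symmetric {f : ℝ → ℝ} {I : Set ℝ} {g : ℝ} (hg : 0 < g)
    (hI : I.OrdConnected) (h0 : (0 : ℝ) ∈ I) (hzero : ∀ y ∉ I, f y = 0)
    (hsym : ∀ y ∈ Icc (-g) g, f (-y) = f y) (hmono : StrictMonoOn f (Iio 0 ∩ I))
    (hnz : ¬ f =ᵐ[volume] 0) : ∃ x ∈ I, 0 < x := by
  by_contra hcon
  push Not at hcon
  have hf : ∀ y, 0 < y → f y = 0 := fun y hy => hzero y fun h => by linarith [hcon y h]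
  by_cases hneg : ∃ x ∈ I, x < 0
  · obtain ⟨x, hx, hx0⟩ := hneg
    set w := max x (-g) with hw
    have hw0 : w < 0 := max_lt hx0 (by linarith)
    have hmem : ∀ y, w ≤ y → y < 0 → y ∈ Iio 0 ∩ I ∧ f y = 0 := by
      intro y h1 h2
      refine ⟨⟨h2, hI.out hx h0 ⟨(le_max_left _ _).trans h1, h2.le⟩⟩, ?_⟩
      rw [← hsym y ⟨(le_max_right _ _).trans h1, by linarith⟩]
      exact hf _ (by linarith)
    obtain ⟨h1, h2⟩ := hmem w le_rfl hw0
    obtain ⟨h3, h4⟩ := hmem (w / 2) (by linarith) (by linarith)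
    have := hmono h1 h3 (by linarith)
    rw [h2, h4] at this
    exact lt_irrefl _ this
  · push Not at hneg
    refine hnz ?_
    filter_upwards [measure_eq_zero_iff_ae_notMem.1 (Real.volume_singleton (a := 0))] with y hy
    refine hzero y fun h => hy ?_
    exact le_antisymm (hcon y h) (hneg y h)

/-- The conditions of `AssumptionA1'` on a density are invariant under reflection, so that each
statement about one side of the peak gives the one about the other side. -/
theorem peak_conditions_comp_neg {f : ℝ → ℝ} {I : Set ℝ} {g : ℝ} (hI : I.OrdConnected)
    (hzero : ∀ y ∉ I, f y = 0) (hsym : ∀ y ∈ Icc (-g) g, f (-y) = f y)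
    (hanti : StrictAntiOn f (Ioi 0 ∩ I)) (hmono : StrictMonoOn f (Iio 0 ∩ I)) :
    (Neg.neg ⁻¹' I).OrdConnected ∧ (∀ y ∉ Neg.neg ⁻¹' I, f (-y) = 0) ∧
      (∀ y ∈ Icc (-g) g, f (- -y) = f (-y)) ∧
      StrictAntiOn (fun y => f (-y)) (Ioi 0 ∩ Neg.neg ⁻¹' I) ∧
      StrictMonoOn (fun y => f (-y)) (Iio 0 ∩ Neg.neg ⁻¹' I) := by
  refine ⟨hI.preimage_anti fun a b h => neg_le_neg h, fun y hy => hzero _ hy,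
    fun y hy => by rw [neg_neg]; exact (hsym y hy).symm, ?_, ?_⟩
  · intro a ha b hb hab
    exact hmono ⟨mem_Iio.2 (neg_lt_zero.2 hb.1), hb.2⟩ ⟨mem_Iio.2 (neg_lt_zero.2 ha.1), ha.2⟩
      (neg_lt_neg hab)
  · intro a ha b hb hab
    exact hanti ⟨mem_Ioi.2 (neg_pos.2 hb.1), hb.2⟩ ⟨mem_Ioi.2 (neg_pos.2 ha.1), ha.2⟩
      (neg_lt_neg hab)

/-- For a fixed scale parameter the limiting slope is that of the smoothed density. -/
theorem AssumptionA1'.isLimitSlope {f L : ℝ → ℝ} {h g : ℕ → ℝ} {g₀ : ℝ} (hA : AssumptionA1' g₀ f)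
    (hfm : Measurable f) (hf0 : ∀ y, 0 ≤ f y) [IsProbabilityMeasure (noiseLaw f)]
    (hL : AssumptionB4' L) (hB : AssumptionB5' h g g₀) :
    ∃ I, IsLimitSlope (noiseLaw f) L h g (meanSlope L (noiseLaw f) g₀) I := by
  obtain ⟨I, hI, h0, hzero, hsym, hanti, hmono⟩ := hA
  obtain ⟨hI', hzero', hsym', hanti', hmono'⟩ :=
    peak_conditions_comp_neg hI hzero hsym hanti hmono
  have hg := hB.g₀_pos
  have hint := integrable_density hfm hf0
  have hnz := not_ae_eq_zero_density f
  obtain ⟨M, hM⟩ := hL.bounded_deriv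
  obtain ⟨C, hC⟩ := hL.lipschitz_deriv
  have hslope : ∀ z, meanSlope L (noiseLaw f) g₀ z =
      1 / g₀ ^ 2 * ∫ u, f u * deriv L ((z - u) / g₀) := by
    intro z
    rw [meanSlope, integral_noiseLaw hfm hf0, ← integral_const_mul]
    simp only [kernelSlope, mul_left_comm]
  have hrefl : ∀ z, ∫ u, f u * deriv L ((z - u) / g₀) =
      -∫ u, f (-u) * deriv L ((-z - u) / g₀) := by
    intro z
    rw [← integral_neg_eq_self (fun u => f u * deriv L ((z - u) / g₀)), ← integral_neg]
    congr 1; ext u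
    rw [show (z - -u) / g₀ = -((-z - u) / g₀) by ring, hL.deriv_neg]
    ring
  have hpix := tendsto_inv_mul_inv hB.h_pos hB.rate_h
  refine ⟨interior I, ?_⟩
  exact
    { differentiable := hL.differentiable
      lipschitz_deriv := hL.lipschitz_deriv
      bounded_deriv := hL.bounded_deriv
      second_moment := by
        refine ⟨M ^ 2 / g₀, fun n z => ?_⟩
        rw [hB.g_const n, div_mul_cancel₀ _ hg.ne']
        have := norm_integral_le_of_norm_le_const (μ := noiseLaw f) (C := M ^ 2)
          (f := fun u => deriv L ((z - u) / g₀) ^ 2) (Eventually.of_forall fun u => by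
            rw [Real.norm_eq_abs, abs_pow]
            exact pow_le_pow_left₀ (abs_nonneg _) (hM _) 2)
        rw [probReal_univ, mul_one] at this
        exact (le_abs_self _).trans this
      h_pos := hB.h_pos
      g_pos := fun n => by rw [hB.g_const]; exact hg
      h_tendsto := hB.h_tendsto
      g_bounded := ⟨g₀, fun n => (hB.g_const n).le⟩
      pixels := hpix
      rate := by
        intro c hc
        simp only [hB.g_const]
        have h1 : Tendsto (fun n : ℕ => (n * h n) ^ 2 * (c * g₀ ^ 3)) atTop atTop :=
          ((tendsto_pow_atTop two_ne_zero).comp hpix).atTop_mul_const (by positivity)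
        have h2 := (Real.tendsto_exp_neg_atTop_nhds_zero.comp h1).const_mul (g₀⁻¹ ^ 3)
        rw [mul_zero] at h2
        refine h2.congr fun n => ?_
        simp only [Function.comp]
        congr 3; ring
      limit := by
        intro τ hτ
        refine Eventually.of_forall fun n z => ?_
        rw [hB.g_const, sub_self, abs_zero]
        exact hτ.le
      lipschitz := by
        refine ⟨Real.toNNReal (C / g₀ ^ 3), LipschitzWith.of_dist_le_mul fun z z' => ?_⟩
        rw [Real.coe_toNNReal _ (by positivity), Real.dist_eq, Real.dist_eq]
        exact abs_meanSlope_sub_le hC hM hg z z'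
      isOpen := isOpen_interior
      ordConnected := hI.interior
      zero_mem := by
        obtain ⟨b, hb, hb0⟩ := exists_pos_mem_of_symmetric hg hI h0 hzero hsym hmono hnz
        obtain ⟨a, ha, ha0⟩ := exists_pos_mem_of_symmetric (f := fun y => f (-y)) hg hI'
          (by simpa using h0) hzero' hsym' hmono' fun h => hnz (by
            have := (Measure.measurePreserving_neg (volume : Measure ℝ)).quasiMeasurePreserving.ae h
            filter_upwards [this] with y hy
            simpa using hy)
        exact interior_maximal (Ioo_subset_Icc_self.trans (hI.out ha hb)) isOpen_Ioo
          ⟨by linarith, hb0⟩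
      carrier := noiseLaw_compl_interior hI hzero
      pos := by
        intro z hz hz0
        have h1 := integral_mul_deriv_neg_of_pos (f := fun y => f (-y)) (z := -z) hL hg
          hint.comp_neg (fun y => hf0 _) hI' (by simpa using h0) hzero' hsym' hanti'
          (by linarith) (by
            rw [mem_interior_iff_mem_nhds] at hz ⊢
            exact continuous_neg.continuousAt.preimage_mem_nhds (by rwa [neg_neg]))
        rw [hslope, hrefl]
        have := mul_pos (by positivity : 0 < 1 / g₀ ^ 2) (neg_pos.2 h1)
        exact this
      neg := by
        intro z hz hz0
        have h1 := integral_mul_deriv_neg_of_pos hL hg hint hf0 hI h0 hzero hsym hanti hz0 hz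
        rw [hslope]
        exact mul_neg_of_pos_of_neg (by positivity) h1 }

/-! ### Consistency off the edges and at the edges -/

theorem IsCentre.norm_sub_le {n : ℕ} {x : Plane} {i j : Fin n} (hc : IsCentre n x i j)
    (hx : x ∈ openSquare) : ‖x - pixel n i j‖ ≤ 1 / n := by
  obtain ⟨p, hp⟩ := exists_mem_cell i.pos hx
  exact (hc.1 p.1 p.2).trans (norm_sub_pixel_le hp)

/-- A weighted sum whose terms are controlled by the oscillation of a continuous function is
small, because the weights concentrate at `x₀`. -/
theorem AssumptionB3.eventually_abs_sum_weight_le {K : Plane → ℝ} (hK : AssumptionB3 K)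
    {x₀ : Plane} (hx₀ : x₀ ∈ openSquare) {h : ℕ → ℝ} (hpos : ∀ n, 0 < h n)
    (hh : Tendsto h atTop (𝓝 0)) (hnh : Tendsto (fun n : ℕ => (n : ℝ) * h n) atTop atTop)
    {u : Plane → ℝ} (hu : ContinuousAt u x₀) (C : NNReal) {τ : ℝ} (hτ : 0 < τ) :
    ∀ᶠ n in atTop, ∀ a : Fin n × Fin n → ℝ,
      (∀ p, ‖x₀ - pixel n p.1 p.2‖ < 2 * h n → |a p| ≤ C * |u (pixel n p.1 p.2) - u x₀|) →
      |∑ p, weight K (h n) n x₀ p * a p| ≤ τ := by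
  set δ := τ / (2 * (C + 1)) with hδ
  have hδ0 : 0 < δ := by positivity
  obtain ⟨r, hr, hur⟩ := Metric.continuousAt_iff.1 hu δ hδ0
  filter_upwards [(hK.tendsto_sum_weight hx₀ hpos hh hnh).eventually
    (gt_mem_nhds (by norm_num : (1 : ℝ) < 2)), hh.eventually (gt_mem_nhds (half_pos hr))]
    with n h1 h2 a ha
  have hterm : ∀ p, |weight K (h n) n x₀ p * a p| ≤ weight K (h n) n x₀ p * (C * δ) := by
    intro p
    have hw := hK.weight_nonneg (h n) n x₀ p
    rcases lt_or_ge ‖x₀ - pixel n p.1 p.2‖ (2 * h n) with hp | hp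
    · rw [abs_mul, abs_of_nonneg hw]
      refine mul_le_mul_of_nonneg_left ((ha p hp).trans ?_) hw
      have := hur (x := pixel n p.1 p.2) (by rw [dist_comm, dist_eq_norm]; linarith)
      rw [Real.dist_eq] at this
      gcongr
    · rw [hK.weight_eq_zero (hpos n) hp]; simp
  calc _ ≤ ∑ p, weight K (h n) n x₀ p * (C * δ) :=
        (Finset.abs_sum_le_sum_abs _ _).trans (Finset.sum_le_sum fun p _ => hterm p)
    _ = (∑ p, weight K (h n) n x₀ p) * (C * δ) := by rw [Finset.sum_mul]
    _ ≤ 2 * ((C + 1) * δ) := by gcongr; linarith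
    _ = τ := by rw [hδ]; field_simp

theorem AssumptionB2.continuousAt {μ : Plane → ℝ} {d : ℝ} {D : Set Plane}
    (hB : AssumptionB2 μ d D) {x₀ : Plane} (hx₀ : x₀ ∈ openSquare) : ContinuousAt μ x₀ :=
  hB.continuousOn.continuousAt
    (mem_of_superset (isOpen_openSquare.mem_nhds hx₀) openSquare_subset_closedSquare)

/-- Off the boundary of `D` the indicator is locally constant. -/
theorem AssumptionB2.continuousAt_trueImage {μ : Plane → ℝ} {d : ℝ} {D : Set Plane}
    (hB : AssumptionB2 μ d D) {x₀ : Plane} (hx₀ : x₀ ∈ openSquare) (hx₀D : x₀ ∉ frontier D) :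
    ContinuousAt (trueImage μ d D) x₀ := by
  refine (hB.continuousAt hx₀).add ?_
  by_cases hx : x₀ ∈ D
  · have hint : x₀ ∈ interior D := by
      by_contra h
      exact hx₀D ⟨subset_closure hx, h⟩
    refine continuousAt_const.congr (f := fun _ => d) ?_
    filter_upwards [mem_interior_iff_mem_nhds.1 hint] with y hy
    rw [indicator_of_mem hy]
  · refine continuousAt_const.congr (f := fun _ => 0) ?_
    filter_upwards [hB.isClosed.isOpen_compl.mem_nhds hx] with y hy
    rw [indicator_of_notMem hy]

section Consistency

variable {Ω : Type*} [MeasurableSpace Ω] {P : Measure Ω} [IsProbabilityMeasure P]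
  {ε : (n : ℕ) → Fin n → Fin n → Ω → ℝ} {f : ℝ → ℝ} {μ : Plane → ℝ} {d : ℝ} {D : Set Plane}
  {K : Plane → ℝ} {L : ℝ → ℝ} {h g : ℕ → ℝ} {φ : ℝ → ℝ} {I : Set ℝ}

theorem IsLimitSlope.consistentInSmoothRegions (hS : IsLimitSlope (noiseLaw f) L h g φ I)
    (hε : IsIIDNoise P ε f) (hB : AssumptionB2 μ d D) (hK : AssumptionB3 K) :
    ConsistentInSmoothRegions P (trueImage μ d D) D
      (mSmoother K L h g (trueImage μ d D) ε) := by
  rintro x₀ ⟨hx₀, hx₀D⟩ η hη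
  have := hε.isProbabilityMeasure_noiseLaw
  have hcont := hB.continuousAt_trueImage hx₀ hx₀D
  set m := trueImage μ d D
  obtain ⟨C, hC⟩ := hS.lipschitz
  refine hS.tendsto_measure_mSmoother (noiseLaw_absolutelyContinuous f) hε.measurable
    hε.law hε.indep hK hx₀ tendsto_id (fun δ hδ => ?_)
    (a₀ := 1 / 2) (by norm_num) (fun τ hτ => ?_) hη
  · obtain ⟨r, hr, hmr⟩ := Metric.continuousAt_iff.1 hcont δ hδ
    filter_upwards [(tendsto_one_div_atTop_nhds_zero_nat (𝕜 := ℝ)).eventually (gt_mem_nhds hr)]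
      with n hn i j hc
    have h1 := hc.norm_sub_le hx₀
    have h2 := hmr (x := pixel n i j) (by rw [dist_comm, dist_eq_norm]; exact h1.trans_lt hn)
    rw [Real.dist_eq] at h2
    exact h2.le
  · filter_upwards [hK.eventually_abs_sum_weight_le hx₀ hS.h_pos hS.h_tendsto hS.pixels hcont C hτ,
      (hK.tendsto_sum_weight hx₀ hS.h_pos hS.h_tendsto hS.pixels).eventually
        (lt_mem_nhds (by norm_num : (1 / 2 : ℝ) < 1))] with n h1 h2
    refine ⟨_, h2.le, fun z _ => ?_⟩
    rw [Finset.sum_mul]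
    simp only [id]
    rw [← Finset.sum_sub_distrib]
    simp only [← mul_sub]
    refine h1 _ fun p _ => ?_
    have h3 := hC.dist_le_mul (z + m x₀ - m (pixel n p.1 p.2)) z
    rw [Real.dist_eq, Real.dist_eq] at h3
    rwa [show z + m x₀ - m (pixel n p.1 p.2) - z = -(m (pixel n p.1 p.2) - m x₀) by ring,
      abs_neg] at h3

/-- At a boundary point the pixels outside `D` contribute a second peak at distance `d`, which does
not overlap the carrier of the first. -/
theorem IsLimitSlope.consistentAlongGrids (hS : IsLimitSlope (noiseLaw f) L h g φ I)
    (hε : IsIIDNoise P ε f) (hB : AssumptionB2 μ d D) (hK : AssumptionB3 K)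
    (hD : closure (interior D) = D) (hφ : ∀ z ∈ I, φ (z + d) = 0) {x₀ : Plane}
    (hx₀D : x₀ ∈ frontier D) :
    ConsistentAlongGrids P (trueImage μ d D)
      (mSmoother K L h g (trueImage μ d D) ε) x₀ := by
  intro s hs hgrid η hη
  have := hε.isProbabilityMeasure_noiseLaw
  have hx₀ : x₀ ∈ openSquare := by
    obtain ⟨i, j, hij⟩ := hgrid 0
    exact hij ▸ pixel_mem_openSquare i j
  obtain ⟨C, hC⟩ := hS.lipschitz
  obtain ⟨a, ha, hsum⟩ := hB.exists_le_sum_weight hK hD hx₀D hx₀ hS.h_pos hS.h_tendsto hS.pixels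
  have hmx₀ : trueImage μ d D x₀ = μ x₀ + d := by
    rw [trueImage, indicator_of_mem (hB.isClosed.frontier_subset hx₀D)]
  refine hS.tendsto_measure_mSmoother (noiseLaw_absolutelyContinuous f) hε.measurable
    hε.law hε.indep hK hx₀ hs.tendsto_atTop (fun δ hδ => Eventually.of_forall fun l i j hc => ?_)
    ha (fun τ hτ => ?_) hη
  · obtain ⟨i', j', hij⟩ := hgrid l
    have h1 := hc.1 i' j'
    rw [hij, sub_self, norm_zero] at h1
    rw [← sub_eq_zero.1 (norm_le_zero_iff.1 h1), sub_self, abs_zero]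
    exact hδ.le
  · filter_upwards [hs.tendsto_atTop.eventually (hK.eventually_abs_sum_weight_le hx₀ hS.h_pos
      hS.h_tendsto hS.pixels (hB.continuousAt hx₀) C hτ), hs.tendsto_atTop.eventually hsum]
      with l h1 h2
    refine ⟨_, h2, fun z hz => ?_⟩
    rw [Finset.sum_mul, ← Finset.sum_sub_distrib]
    have e : ∀ p : Fin (s l) × Fin (s l), weight K (h (s l)) (s l) x₀ p *
        φ (z + trueImage μ d D x₀ - trueImage μ d D (pixel (s l) p.1 p.2)) -
        D.indicator (fun _ => weight K (h (s l)) (s l) x₀ p) (pixel (s l) p.1 p.2) * φ z =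
        weight K (h (s l)) (s l) x₀ p *
        (φ (z + trueImage μ d D x₀ - trueImage μ d D (pixel (s l) p.1 p.2)) -
          D.indicator (fun _ => φ z) (pixel (s l) p.1 p.2)) := by
      intro p
      by_cases hp : pixel (s l) p.1 p.2 ∈ D
      · rw [indicator_of_mem hp, indicator_of_mem hp]; ring
      · rw [indicator_of_notMem hp, indicator_of_notMem hp]; ring
    simp only [e]
    refine h1 _ fun p _ => ?_
    set x := pixel (s l) p.1 p.2
    by_cases hp : x ∈ D
    · have h3 := hC.dist_le_mul (z + trueImage μ d D x₀ - trueImage μ d D x) z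
      rw [Real.dist_eq, Real.dist_eq] at h3
      rw [indicator_of_mem hp]
      rw [hmx₀, trueImage, indicator_of_mem hp] at h3 ⊢
      rwa [show z + (μ x₀ + d) - (μ x + d) - z = -(μ x - μ x₀) by ring, abs_neg] at h3
    · have h3 := hC.dist_le_mul (z + trueImage μ d D x₀ - trueImage μ d D x) (z + d)
      rw [Real.dist_eq, Real.dist_eq, hφ z hz] at h3
      rw [indicator_of_notMem hp]
      rw [hmx₀, trueImage, indicator_of_notMem hp, add_zero] at h3 ⊢
      rwa [show z + (μ x₀ + d) - μ x - (z + d) = -(μ x - μ x₀) by ring, abs_neg] at h3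

theorem IsLimitSlope.cornerPreserving (hS : IsLimitSlope (noiseLaw f) L h g φ I)
    (hε : IsIIDNoise P ε f) (hB : AssumptionB2 μ d D) (hK : AssumptionB3 K)
    (hD : closure (interior D) = D) (hφ : ∀ z ∈ I, φ (z + d) = 0) :
    CornerPreserving P (trueImage μ d D) D (mSmoother K L h g (trueImage μ d D) ε) :=
  ⟨fun _ hx _ _ => hS.consistentAlongGrids hε hB hK hD hφ hx,
    fun _ _ _ hx _ _ => hS.consistentAlongGrids hε hB hK hD hφ hx⟩

end Consistency

theorem deriv_add_eq_zero_of_support {f : ℝ → ℝ} {a₁ a₂ d z : ℝ} (h0 : ∀ y ∉ Ioo a₁ a₂, f y = 0)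
    (had : a₂ - a₁ < d) (hz : z ∈ Ioo a₁ a₂) : deriv f (z + d) = 0 := by
  have : f =ᶠ[𝓝 (z + d)] fun _ => 0 := by
    filter_upwards [lt_mem_nhds (show a₂ < z + d by linarith [hz.1])] with y hy
    exact h0 y fun h => by linarith [h.2]
  rw [this.deriv_eq, deriv_const]

theorem meanSlope_add_eq_zero_of_support {f L : ℝ → ℝ} {a g d z : ℝ} (hL : AssumptionB4' L)
    (hg : 0 < g) (hfm : Measurable f) (hf0 : ∀ y, 0 ≤ f y) (h0 : ∀ y ∉ Ioo (-a) a, f y = 0)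
    (had : 2 * a + 2 * g < d) (hz : z ∈ Ioo (-a) a) : meanSlope L (noiseLaw f) g (z + d) = 0 := by
  rw [meanSlope, integral_noiseLaw hfm hf0]
  refine integral_eq_zero_of_ae (Eventually.of_forall fun u => ?_)
  show f u * kernelSlope L g (z + d - u) = 0
  by_cases hu : u ∈ Ioo (-a) a
  · have h1 : g ≤ z + d - u := by linarith [hz.1, hu.2]
    rw [kernelSlope, hL.deriv_eq_zero, mul_zero, mul_zero]
    rw [abs_div, abs_of_pos hg, one_le_div hg]
    exact h1.trans (le_abs_self _)
  · rw [h0 u hu, zero_mul]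

theorem theorem1 {Ω : Type*} [MeasurableSpace Ω] (P : Measure Ω) [IsProbabilityMeasure P]
    (ε : (n : ℕ) → Fin n → Fin n → Ω → ℝ) (f : ℝ → ℝ) (hε : IsIIDNoise P ε f)
    (μ : Plane → ℝ) (d : ℝ) (D : Set Plane) (K : Plane → ℝ) (L : ℝ → ℝ) (h g : ℕ → ℝ) :
    ((AssumptionA1 f ∧ AssumptionB μ d D K L h g ∨
        ∃ g₀, AssumptionA1' g₀ f ∧ AssumptionB' μ d D K L h g g₀) →
      ConsistentInSmoothRegions P (trueImage μ d D) D (mSmoother K L h g (trueImage μ d D) ε)) ∧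
    (closure (interior D) = D →
      (AssumptionA2 d f ∧ AssumptionB μ d D K L h g ∨
        ∃ g₀, AssumptionA2' g₀ d f ∧ AssumptionB' μ d D K L h g g₀) →
      CornerPreserving P (trueImage μ d D) D (mSmoother K L h g (trueImage μ d D) ε)) := by
  have := hε.isProbabilityMeasure_noiseLaw
  have hfm := hε.density_measurable
  have hf0 := hε.density_nonneg
  refine ⟨?_, fun hD => ?_⟩
  · rintro (⟨hA, hB2, hK, hL, hB5⟩ | ⟨g₀, hA, hB2, hK, hL, hB5⟩)
    · obtain ⟨I, hS, -⟩ := hA.isLimitSlope hfm hf0 hL hB5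
      exact hS.consistentInSmoothRegions hε hB2 hK
    · obtain ⟨I, hS⟩ := hA.isLimitSlope hfm hf0 hL hB5
      exact hS.consistentInSmoothRegions hε hB2 hK
  · rintro (⟨⟨hA, a₁, a₂, ha, had⟩, hB2, hK, hL, hB5⟩ |
      ⟨g₀, ⟨hA, a, ha, had⟩, hB2, hK, hL, hB5⟩)
    · obtain ⟨I, hS, hf00⟩ := hA.isLimitSlope hfm hf0 hL hB5
      have h0 : (0 : ℝ) ∈ Ioo a₁ a₂ := by
        by_contra hcon
        exact hf00.ne' (ha 0 hcon)
      exact (hS.inter isOpen_Ioo ordConnected_Ioo h0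
        (noiseLaw_compl_eq_zero measurableSet_Ioo ha)).cornerPreserving hε hB2 hK hD
          fun z hz => deriv_add_eq_zero_of_support ha had hz.2
    · obtain ⟨I, hS⟩ := hA.isLimitSlope hfm hf0 hL hB5
      have ha0 : 0 < a := by
        by_contra hcon
        refine not_ae_eq_zero_density f (Eventually.of_forall fun y => ha y fun hy => ?_)
        linarith [hy.1, hy.2]
      exact (hS.inter isOpen_Ioo ordConnected_Ioo ⟨neg_lt_zero.2 ha0, ha0⟩
        (noiseLaw_compl_eq_zero measurableSet_Ioo ha)).cornerPreserving hε hB2 hK hD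
          fun z hz => meanSlope_add_eq_zero_of_support hL hB5.g₀_pos hfm hf0 ha had hz.2
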